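/- Let $\mathbb D$ be the open unit disk and $\mathbb T$ the unit circle. Let $\omega$ be a Schur function, i.e. an analytic function on $\mathbb D$ with $|\omega|\le 1$, and for a.e. $t\in\mathbb T$ let $\omega(t)$ denote its nontangential boundary limit at $t$. Let $t_0\in\mathbb T$ and $b\in\mathbb C$, and put $$D_{\omega,b}(t_0)=\int_{\mathbb T}\frac{1}{|1-t\bar t_0|^2}\begin{bmatrix}1&-b\end{bmatrix}\begin{bmatrix}1&\omega(t)\\ \overline{\omega(t)}&1\end{bmatrix}\begin{bmatrix}1\\-\bar b\end{bmatrix}m(dt)\in[0,\infty],$$ where $m$ is the normalized Lebesgue measure on $\mathbb T$. Nontangential limits at $t_0$ are limits as $z\to t_0$ inside each region $\{z\in\mathbb D:|t_0-z|<a(1-|z|)\}$, $a>1$; the lower limits below are taken over unrestricted $z\to t_0$, $z\in\mathbb D$. Then: 1. $D_{\omega,b}(t_0)<\infty$ if and only if $\displaystyle\liminf_{z\to t_0}\frac{1-|\omega(z)|^2}{1-|z|^2}<\infty$ and $\omega$ has the nontangential limit $b$ at $t_0$. In this case $|b|=1$. 2. $D_{\omega,b}(t_0)=\infty$ if and only if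 either $\displaystyle\liminf_{z\to t_0}\frac{1-|\omega(z)|^2}{1-|z|^2}=\infty$ or $\omega$ fails to have the nontangential limit $b$ at $t_0$. 3. $D_{\omega,b}(t_0)=0$ if and only if $\omega(z)=b$ for all $z\in\mathbb D$ and $|b|=1$. 4. If $|b|\le 1$, then, as a nontangential limit, $$\lim_{z\to t_0}\frac{1-\omega(z)\bar b}{1-z\bar t_0}=D_{\omega,b}(t_0),$$ whether $D_{\omega,b}(t_0)$ is finite or infinite; when $D_{\omega,b}(t_0)=\infty$ this means that the modulus of the quotient tends to $+\infty$. -/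

import Mathlib

open Filter Topology MeasureTheory
open scoped Matrix

/-- The Schur class: functions that are analytic on the open unit disk and map it into the
closed unit disk. Values outside the open disk are irrelevant. -/
def IsSchur (ω : ℂ → ℂ) : Prop :=
  DifferentiableOn ℂ ω (Metric.ball 0 1) ∧ ∀ z ∈ Metric.ball (0 : ℂ) 1, ‖ω z‖ ≤ 1

/-- The nontangential approach region `{z ∈ 𝔻 : |t - z| < a (1 - |z|)}` at the point `t`. -/
noncomputable def stolzRegion (a : ℝ) (t : ℂ) : Set ℂ :=
  {z | z ∈ Metric.ball (0 : ℂ) 1 ∧ ‖t - z‖ < a * (1 - ‖z‖)}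

/-- The filter of nontangential approach to `t`: a function tends to `l` along it if and only if
it tends to `l` as `z → t` inside every region `stolzRegion a t` with `a > 1`. -/
noncomputable def nontangential (t : ℂ) : Filter ℂ :=
  ⨆ (a : ℝ) (_ : 1 < a), 𝓝[stolzRegion a t] t

/-- The boundary function: the nontangential limit of `ω` at `t`
(with a meaningless value where there is no such limit). -/
noncomputable def boundaryValue (ω : ℂ → ℂ) (t : ℂ) : ℂ :=
  limUnder (nontangential t) ω

/-- The quadratic form `[1, -b] * [[1, v], [v*, 1]] * [1, -b*]ᵀ` (which is real). -/
noncomputable def quadForm (v b : ℂ) : ℝ :=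
  (![1, -b] ⬝ᵥ (!![1, v; star v, 1] *ᵥ ![1, -star b])).re

/-- The quantity `D_{ω,b}(t₀)` in `[0, ∞]`; the points of the circle are `t = exp (iθ)`,
and `(2π)⁻¹ dθ` is the normalized Lebesgue measure. -/
noncomputable def juliaD (ω : ℂ → ℂ) (b t₀ : ℂ) : ENNReal :=
  ENNReal.ofReal (2 * Real.pi)⁻¹ *
    ∫⁻ θ in Set.Ioc (0 : ℝ) (2 * Real.pi),
      ENNReal.ofReal
        (1 / ‖1 - Complex.exp (θ * Complex.I) * star t₀‖ ^ 2 *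
          quadForm (boundaryValue ω (Complex.exp (θ * Complex.I))) b)

/-- The (unrestricted) limit inferior, in the extended reals, of
`(1 - |ω(z)|²) / (1 - |z|²)` as `z → t₀` inside the open unit disk. -/
noncomputable def juliaLiminf (ω : ℂ → ℂ) (t₀ : ℂ) : EReal :=
  liminf (fun z : ℂ => (((1 - ‖ω z‖ ^ 2) / (1 - ‖z‖ ^ 2) : ℝ) : EReal))
    (𝓝[Metric.ball (0 : ℂ) 1] t₀)

/-! The form is at least `(1 - |b|)²`, while `1/|e - t|²` is not integrable on the circle, so a
finite `D` forces `|b| = 1`. For such `b` the form equals `2 Re F`, where `F` is the boundary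
function of `f = 1 - ω b*`, and `Re f ≥ 0`. Everything then concerns `H = 2 Re F / |e - t|²`, whose
integral is `D`.

If `H` is integrable, adding the Cauchy formulas for `F` and `F*` gives `f(z) = c + (1 - z t*) ∫ (e
- t)/(e - z) H` with `c` purely imaginary (`exists_eq_add_mul_integral`). The kernel is bounded on
Stolz regions and tends to 1, so the integral tends to `D`. Since `|1 - f| ≤ 1`, also `c = 0`, and
`f/(1 - z t*) → D`. This gives `ω → b`, a finite lower limit along the radius, and `f = 0` when `D =
0`.

Conversely, a finite lower limit gives Julia's inequality with some unimodular `b'` (Schwarz-Pick in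
the limit). Then `ω → b'` nontangentially, hence `b' = b`. Fatou's lemma for Poisson integrals
bounds `D` by lower limits of `2 Re f(x)/(1 - |x|²)` as `x → t` (`juliaD_le_liminf`). Julia's
inequality bounds these on the radius, so `D` is finite. If `D = ∞` and `|b| = 1`, the same bound
makes the quotient blow up. If `|b| < 1`, its numerator stays away from 0.

Boundary values exist a.e. because a bounded analytic function has a Lipschitz primitive, which is
a.e. differentiable along the circle. -/

/-! ### The circle as a probability space -/

/-- The normalized Lebesgue measure on `(0, 2π]`. -/
noncomputable def angleMeasure : Measure ℝ :=
  ENNReal.ofReal (2 * Real.pi)⁻¹ • volume.restrict (Set.Ioc (0 : ℝ) (2 * Real.pi))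

/-- The parametrization `θ ↦ exp (iθ)` of the unit circle. -/
noncomputable def unitExp (θ : ℝ) : ℂ := Complex.exp (θ * Complex.I)

instance isProbabilityMeasure_angleMeasure : IsProbabilityMeasure angleMeasure := by
  constructor
  have h : (0 : ℝ) < 2 * Real.pi := by positivity
  simp only [angleMeasure, Measure.smul_apply, MeasurableSet.univ, Measure.restrict_apply,
    Set.univ_inter, Real.volume_Ioc, sub_zero, smul_eq_mul]
  rw [← ENNReal.ofReal_mul (by positivity), inv_mul_cancel₀ h.ne', ENNReal.ofReal_one]

theorem ae_angleMeasure_of_ae {p : ℝ → Prop} (h : ∀ᵐ θ, p θ) : ∀ᵐ θ ∂angleMeasure, p θ :=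
  Measure.ae_smul_measure (ae_restrict_of_ae h) _

@[simp] theorem norm_unitExp (θ : ℝ) : ‖unitExp θ‖ = 1 := Complex.norm_exp_ofReal_mul_I θ

theorem continuous_unitExp : Continuous unitExp := by unfold unitExp; fun_prop

theorem unitExp_ne_zero (θ : ℝ) : unitExp θ ≠ 0 := Complex.exp_ne_zero _

theorem integral_angleMeasure_eq_circleAverage (f : ℂ → ℂ) :
    ∫ θ, f (unitExp θ) ∂angleMeasure = Real.circleAverage f 0 1 := by
  have h : (0 : ℝ) ≤ 2 * Real.pi := by positivity
  rw [Real.circleAverage_def, angleMeasure, integral_smul_measure,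
    ENNReal.toReal_ofReal (by positivity), intervalIntegral.integral_of_le h]
  simp [unitExp, circleMap]

theorem unitExp_sub_ne_zero {z : ℂ} (hz : ‖z‖ < 1) (θ : ℝ) : unitExp θ - z ≠ 0 := by
  intro h
  have := norm_unitExp θ
  rw [sub_eq_zero.1 h] at this
  linarith

theorem one_sub_norm_le_norm_unitExp_sub (z : ℂ) (θ : ℝ) : 1 - ‖z‖ ≤ ‖unitExp θ - z‖ := by
  simpa using norm_sub_norm_le (unitExp θ) z

theorem ae_unitExp_ne (t : ℂ) : ∀ᵐ θ ∂angleMeasure, unitExp θ ≠ t := by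
  apply ae_angleMeasure_of_ae
  have hc : (unitExp ⁻¹' {t}).Countable := by
    by_cases h : ∃ θ₀, unitExp θ₀ = t
    · obtain ⟨θ₀, rfl⟩ := h
      refine (Set.countable_range (fun n : ℤ => θ₀ + n * (2 * Real.pi))).mono ?_
      intro θ hθ
      obtain ⟨n, hn⟩ := Complex.exp_eq_exp_iff_exists_int.1 (show
        Complex.exp (θ * Complex.I) = Complex.exp (θ₀ * Complex.I) from hθ)
      refine ⟨n, ?_⟩
      have h2 : (θ : ℂ) = θ₀ + n * (2 * Real.pi) := by
        have h3 : (θ : ℂ) * Complex.I = (θ₀ + n * (2 * Real.pi)) * Complex.I := by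
          rw [hn]; ring
        exact mul_right_cancel₀ Complex.I_ne_zero h3
      exact_mod_cast h2.symm
    · convert Set.countable_empty
      ext θ
      simp only [Set.mem_preimage, Set.mem_singleton_iff, Set.mem_empty_iff_false, iff_false]
      exact fun hθ => h ⟨θ, hθ⟩
  have := hc.measure_zero volume
  rw [ae_iff]
  convert this using 2
  ext θ
  simp

/-! ### Bounded analytic functions and their radial boundary values -/

/-- `g` is a bounded analytic function on the unit disk with the radial boundary values `G`. -/
structure HasRadialBoundary (g : ℂ → ℂ) (G : ℝ → ℂ) (C : ℝ) : Prop where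
  differentiableOn : DifferentiableOn ℂ g (Metric.ball 0 1)
  norm_le : ∀ z ∈ Metric.ball (0 : ℂ) 1, ‖g z‖ ≤ C
  tendsto : ∀ᵐ θ ∂angleMeasure,
    Tendsto (fun r : ℝ => g (r * unitExp θ)) (𝓝[<] 1) (𝓝 (G θ))

theorem eventually_mem_Ioo_nhdsLT_one : ∀ᶠ r : ℝ in 𝓝[<] 1, 0 < r ∧ r < 1 :=
  Ioo_mem_nhdsLT (show (0 : ℝ) < 1 by norm_num)

theorem ofReal_mul_mem_ball {r : ℝ} (hr : 0 < r ∧ r < 1) {w : ℂ} (hw : ‖w‖ ≤ 1) :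
    (r : ℂ) * w ∈ Metric.ball (0 : ℂ) 1 := by
  rw [mem_ball_zero_iff, norm_mul, Complex.norm_real, Real.norm_of_nonneg hr.1.le]
  nlinarith [norm_nonneg w]

namespace HasRadialBoundary

variable {g : ℂ → ℂ} {G : ℝ → ℂ} {C : ℝ}

theorem eventually_continuous_radial (h : HasRadialBoundary g G C) :
    ∀ᶠ r : ℝ in 𝓝[<] 1,
      Continuous (fun θ => g (r * unitExp θ)) := by
  filter_upwards [eventually_mem_Ioo_nhdsLT_one] with r hr
  refine h.differentiableOn.continuousOn.comp_continuous
    (continuous_const.mul continuous_unitExp) fun θ => ?_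
  exact ofReal_mul_mem_ball hr (by simp)

/-- Measurability of `G` is not assumed: it is inherited from the continuous functions `θ ↦ g (r *
unitExp θ)` along a sequence of radii tending to 1. -/
theorem aestronglyMeasurable (h : HasRadialBoundary g G C) :
    AEStronglyMeasurable G angleMeasure := by
  obtain ⟨u, -, hu1, hu2⟩ := exists_seq_strictMono_tendsto' (show (0 : ℝ) < 1 by norm_num)
  have hu : Tendsto u atTop (𝓝[<] 1) := by
    refine tendsto_nhdsWithin_iff.2 ⟨hu2, ?_⟩
    filter_upwards with n
    exact (hu1 n).2
  obtain ⟨N, hN⟩ := eventually_atTop.1 (hu.eventually h.eventually_continuous_radial)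
  refine aestronglyMeasurable_of_tendsto_ae (u := atTop)
    (f := fun n θ => g (u (n + N) * unitExp θ))
    (fun n => (hN (n + N) (by omega)).aestronglyMeasurable) ?_
  filter_upwards [h.tendsto] with θ hθ
  exact hθ.comp (hu.comp (tendsto_add_atTop_nat N))

theorem ae_norm_le (h : HasRadialBoundary g G C) : ∀ᵐ θ ∂angleMeasure, ‖G θ‖ ≤ C := by
  filter_upwards [h.tendsto] with θ hθ
  refine le_of_tendsto hθ.norm ?_
  filter_upwards [eventually_mem_Ioo_nhdsLT_one] with r hr
  exact h.norm_le _ (ofReal_mul_mem_ball hr (by simp))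

theorem integrable_mul (h : HasRadialBoundary g G C) {k : ℝ → ℂ} (hk : Continuous k) {K : ℝ}
    (hK : ∀ θ, ‖k θ‖ ≤ K) : Integrable (fun θ => k θ * G θ) angleMeasure := by
  refine Integrable.of_bound (hk.aestronglyMeasurable.mul h.aestronglyMeasurable) (K * C) ?_
  filter_upwards [h.ae_norm_le] with θ hθ
  rw [norm_mul]
  exact mul_le_mul (hK θ) hθ (norm_nonneg _) ((norm_nonneg _).trans (hK θ))

theorem tendsto_integral_mul (h : HasRadialBoundary g G C) {k : ℝ → ℂ} (hk : Continuous k) {K : ℝ}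
    (hK : ∀ θ, ‖k θ‖ ≤ K) :
    Tendsto (fun r : ℝ => ∫ θ, k θ * g (r * unitExp θ) ∂angleMeasure) (𝓝[<] 1)
      (𝓝 (∫ θ, k θ * G θ ∂angleMeasure)) := by
  refine tendsto_integral_filter_of_dominated_convergence (fun _ => K * C) ?_ ?_
    (integrable_const _) ?_
  · filter_upwards [h.eventually_continuous_radial] with r hr
    exact (hk.mul hr).aestronglyMeasurable
  · filter_upwards [eventually_mem_Ioo_nhdsLT_one] with r hr
    filter_upwards with θ
    rw [norm_mul]
    exact mul_le_mul (hK θ) (h.norm_le _ (ofReal_mul_mem_ball hr (by simp))) (norm_nonneg _)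
      ((norm_nonneg _).trans (hK θ))
  · filter_upwards [h.tendsto] with θ hθ
    exact hθ.const_mul _

theorem diffContOnCl_dilation (h : HasRadialBoundary g G C) {r : ℝ} (hr : 0 < r ∧ r < 1) :
    DiffContOnCl ℂ (fun z => g (r * z)) (Metric.ball 0 1) := by
  refine DifferentiableOn.diffContOnCl ?_
  rw [closure_ball _ one_ne_zero]
  refine h.differentiableOn.comp (by fun_prop) fun z hz => ?_
  exact ofReal_mul_mem_ball hr (by simpa using hz)

theorem tendsto_dilation (h : HasRadialBoundary g G C) {z : ℂ} (hz : ‖z‖ < 1) :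
    Tendsto (fun r : ℝ => g (r * z)) (𝓝[<] 1) (𝓝 (g z)) := by
  have h1 : ContinuousAt g z :=
    (h.differentiableOn.differentiableAt
      (Metric.isOpen_ball.mem_nhds (by simpa using hz))).continuousAt
  have h2 : Tendsto (fun r : ℝ => (r : ℂ) * z) (𝓝[<] 1) (𝓝 z) := by
    have : Tendsto (fun r : ℝ => (r : ℂ) * z) (𝓝 1) (𝓝 (((1 : ℝ) : ℂ) * z)) :=
      Continuous.tendsto (by fun_prop) 1
    simp only [Complex.ofReal_one, one_mul] at this
    exact this.mono_left nhdsWithin_le_nhds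
  exact h1.tendsto.comp h2

end HasRadialBoundary

/-! ### Cauchy and Poisson formulas -/

theorem continuous_div_unitExp_sub {z : ℂ} (hz : ‖z‖ < 1) :
    Continuous fun θ => unitExp θ / (unitExp θ - z) :=
  continuous_unitExp.div (continuous_unitExp.sub continuous_const) (unitExp_sub_ne_zero hz)

theorem norm_div_unitExp_sub_le {z : ℂ} (hz : ‖z‖ < 1) (θ : ℝ) :
    ‖unitExp θ / (unitExp θ - z)‖ ≤ 1 / (1 - ‖z‖) := by
  rw [norm_div, norm_unitExp]
  exact one_div_le_one_div_of_le (by linarith) (one_sub_norm_le_norm_unitExp_sub z θ)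

/-- The Poisson kernel of the unit disk, in the angular variable. -/
noncomputable def diskPoisson (z : ℂ) (θ : ℝ) : ℝ := (1 - ‖z‖ ^ 2) / ‖unitExp θ - z‖ ^ 2

theorem diskPoisson_nonneg {z : ℂ} (hz : ‖z‖ < 1) (θ : ℝ) : 0 ≤ diskPoisson z θ := by
  unfold diskPoisson
  have : 0 ≤ 1 - ‖z‖ ^ 2 := by nlinarith [norm_nonneg z]
  positivity

theorem continuous_diskPoisson {z : ℂ} (hz : ‖z‖ < 1) : Continuous (diskPoisson z) := by
  unfold diskPoisson
  refine continuous_const.div ((continuous_unitExp.sub continuous_const).norm.pow 2) fun θ => ?_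
  exact pow_ne_zero _ (norm_ne_zero_iff.2 (unitExp_sub_ne_zero hz θ))

theorem diskPoisson_le {z : ℂ} (hz : ‖z‖ < 1) (θ : ℝ) :
    diskPoisson z θ ≤ (1 - ‖z‖ ^ 2) / (1 - ‖z‖) ^ 2 := by
  unfold diskPoisson
  have h0 : 0 < 1 - ‖z‖ := by linarith
  have h1 := one_sub_norm_le_norm_unitExp_sub z θ
  have : 0 ≤ 1 - ‖z‖ ^ 2 := by nlinarith [norm_nonneg z]
  gcongr

theorem norm_ofReal_diskPoisson_le {z : ℂ} (hz : ‖z‖ < 1) (θ : ℝ) :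
    ‖(diskPoisson z θ : ℂ)‖ ≤ (1 - ‖z‖ ^ 2) / (1 - ‖z‖) ^ 2 := by
  rw [Complex.norm_real, Real.norm_of_nonneg (diskPoisson_nonneg hz θ)]
  exact diskPoisson_le hz θ

theorem diskPoisson_eq {z : ℂ} (hz : ‖z‖ < 1) (θ : ℝ) :
    (diskPoisson z θ : ℂ) = unitExp θ / (unitExp θ - z)
      + star (unitExp θ / (unitExp θ - z)) - 1 := by
  have h1 := unitExp_sub_ne_zero hz θ
  have h2 : star (unitExp θ - z) ≠ 0 := star_ne_zero.2 h1
  have h3 : ((‖unitExp θ - z‖ : ℂ)) ^ 2 = (unitExp θ - z) * star (unitExp θ - z) :=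
    (Complex.mul_conj' _).symm
  have h4 : unitExp θ * star (unitExp θ) = 1 := by
    have := Complex.mul_conj' (unitExp θ)
    simpa using this
  have h5 : (‖z‖ : ℂ) ^ 2 = z * star z := (Complex.mul_conj' _).symm
  unfold diskPoisson
  push_cast
  rw [h3, h5, star_div₀]
  field_simp
  rw [star_sub]
  linear_combination -h4

namespace HasRadialBoundary

variable {g : ℂ → ℂ} {G : ℝ → ℂ} {C : ℝ}

/-- The dilations `g (r * z)` are analytic up to the circle, where the classical formula applies;
dominated convergence lets `r → 1`. -/
theorem cauchy_formula (h : HasRadialBoundary g G C) {z : ℂ} (hz : ‖z‖ < 1) :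
    ∫ θ, unitExp θ / (unitExp θ - z) * G θ ∂angleMeasure = g z := by
  refine tendsto_nhds_unique (h.tendsto_integral_mul (continuous_div_unitExp_sub hz)
    (norm_div_unitExp_sub_le hz)) ((h.tendsto_dilation hz).congr' ?_)
  filter_upwards [eventually_mem_Ioo_nhdsLT_one] with r hr
  have h1 := DiffContOnCl.circleAverage_smul_div (R := 1) (c := 0) (w := z)
    (by simpa using h.diffContOnCl_dilation hr) (by simpa using hz)
  rw [← h1, ← integral_angleMeasure_eq_circleAverage]
  simp

theorem integrable_diskPoisson_mul (h : HasRadialBoundary g G C) {z : ℂ} (hz : ‖z‖ < 1) :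
    Integrable (fun θ => (diskPoisson z θ : ℂ) * G θ) angleMeasure :=
  h.integrable_mul (Complex.continuous_ofReal.comp (continuous_diskPoisson hz))
    (norm_ofReal_diskPoisson_le hz)

theorem poisson_formula (h : HasRadialBoundary g G C) {z : ℂ} (hz : ‖z‖ < 1) :
    ∫ θ, (diskPoisson z θ : ℂ) * G θ ∂angleMeasure = g z := by
  refine tendsto_nhds_unique (h.tendsto_integral_mul
    (Complex.continuous_ofReal.comp (continuous_diskPoisson hz)) (norm_ofReal_diskPoisson_le hz))
    ((h.tendsto_dilation hz).congr' ?_)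
  filter_upwards [eventually_mem_Ioo_nhdsLT_one] with r hr
  have h1 := (h.diffContOnCl_dilation hr).circleAverage_poissonKernel_smul (w := z)
    (by simpa using hz)
  rw [← h1, ← integral_angleMeasure_eq_circleAverage]
  simp [poissonKernel_def, diskPoisson]

/-- By `diskPoisson_eq`, the conjugate Cauchy kernel is the Poisson kernel minus the Cauchy kernel
plus 1. Integrated against `G`, these give `g z - g z + g 0`; conjugation finishes. -/
theorem cauchy_formula_star (h : HasRadialBoundary g G C) {z : ℂ} (hz : ‖z‖ < 1) :
    ∫ θ, unitExp θ / (unitExp θ - z) * star (G θ) ∂angleMeasure = star (g 0) := by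
  have h0 : ∫ θ, G θ ∂angleMeasure = g 0 := by
    rw [← h.cauchy_formula (z := 0) (by simp)]
    simp [unitExp_ne_zero]
  have key : ∫ θ, star (unitExp θ / (unitExp θ - z)) * G θ ∂angleMeasure = g 0 := by
    have e1 : ∀ θ, star (unitExp θ / (unitExp θ - z)) * G θ
        = (diskPoisson z θ : ℂ) * G θ - unitExp θ / (unitExp θ - z) * G θ + G θ := fun θ => by
      rw [diskPoisson_eq hz]; ring
    simp_rw [e1]
    have i1 := h.integrable_diskPoisson_mul hz
    have i2 := h.integrable_mul (continuous_div_unitExp_sub hz) (norm_div_unitExp_sub_le hz)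
    have i3 : Integrable G angleMeasure := by
      simpa using h.integrable_mul (k := fun _ => 1) continuous_const (K := 1) (by simp)
    rw [integral_add (f := fun θ => _ - _) (i1.sub i2) i3, integral_sub i1 i2,
      h.cauchy_formula hz, h.poisson_formula hz,
      h0]
    ring
  have := integral_conj (μ := angleMeasure)
    (f := fun θ => star (unitExp θ / (unitExp θ - z)) * G θ)
  rw [key] at this
  change _ = (starRingEnd ℂ) (g 0)
  rw [← this]
  congr 1
  ext θ
  simp

theorem re_poisson_formula (h : HasRadialBoundary g G C) {z : ℂ} (hz : ‖z‖ < 1) :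
    ∫ θ, diskPoisson z θ * (G θ).re ∂angleMeasure = (g z).re := by
  have i1 := h.integrable_diskPoisson_mul hz
  rw [← h.poisson_formula hz]
  have := integral_re i1
  simp only [RCLike.re_to_complex] at this
  rw [← this]
  simp

theorem integrable_re (h : HasRadialBoundary g G C) {z : ℂ} (hz : ‖z‖ < 1) :
    Integrable (fun θ => diskPoisson z θ * (G θ).re) angleMeasure := by
  have i1 := h.integrable_diskPoisson_mul hz
  simpa using i1.re

end HasRadialBoundary

/-- The radial boundary values of an entire function are its values on the circle. -/
theorem hasRadialBoundary_of_differentiable {g : ℂ → ℂ} (hg : Differentiable ℂ g) :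
    ∃ C, HasRadialBoundary g (fun θ => g (unitExp θ)) C := by
  obtain ⟨C, hC⟩ := (isCompact_closedBall (0 : ℂ) 1).exists_bound_of_continuousOn
    hg.continuous.continuousOn
  refine ⟨C, hg.differentiableOn, fun z hz => hC z (Metric.ball_subset_closedBall hz), ?_⟩
  filter_upwards with θ
  have : Tendsto (fun r : ℝ => g (r * unitExp θ)) (𝓝 1) (𝓝 (g (((1 : ℝ) : ℂ) * unitExp θ))) :=
    (hg.continuous.comp (by fun_prop : Continuous fun r : ℝ => (r : ℂ) * unitExp θ)).tendsto 1
  simp only [Complex.ofReal_one, one_mul] at this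
  exact this.mono_left nhdsWithin_le_nhds

theorem integral_diskPoisson {z : ℂ} (hz : ‖z‖ < 1) :
    ∫ θ, diskPoisson z θ ∂angleMeasure = 1 := by
  obtain ⟨C, hC⟩ := hasRadialBoundary_of_differentiable (g := fun _ => 1) (by fun_prop)
  simpa using hC.re_poisson_formula hz

theorem norm_unitExp_sub_sq {t : ℂ} (ht : ‖t‖ = 1) (θ : ℝ) :
    ‖unitExp θ - t‖ ^ 2 = 2 * (1 - unitExp θ * star t).re := by
  have h1 : ‖unitExp θ‖ ^ 2 = 1 := by simp
  have h2 : ‖t‖ ^ 2 = 1 := by simp [ht]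
  rw [← Complex.normSq_eq_norm_sq, Complex.normSq_apply] at *
  simp at *
  nlinarith

/-- On the circle `|w - t|²` is the real part of the entire function `2(1 - w t*)`. The resulting
value tends to 0 as `z → t`, which measures how the Poisson kernel concentrates at `t`. -/
theorem integral_diskPoisson_mul_norm_sq {z t : ℂ} (hz : ‖z‖ < 1) (ht : ‖t‖ = 1) :
    ∫ θ, diskPoisson z θ * ‖unitExp θ - t‖ ^ 2 ∂angleMeasure = 2 * (1 - z * star t).re := by
  obtain ⟨C, hC⟩ := hasRadialBoundary_of_differentiable (g := fun w => 2 * (1 - w * star t))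
    (by fun_prop)
  have := hC.re_poisson_formula hz
  have e : ∀ w : ℂ, (2 * w).re = 2 * w.re := fun w => by simp
  simp only [e] at this
  rw [← this]
  simp_rw [norm_unitExp_sub_sq ht]

/-! ### Nontangential approach -/

theorem tendsto_nontangential_iff {α : Type*} {f : ℂ → α} {t : ℂ} {l : Filter α} :
    Tendsto f (nontangential t) l ↔ ∀ a : ℝ, 1 < a → Tendsto f (𝓝[stolzRegion a t] t) l := by
  simp only [nontangential, tendsto_iSup]

theorem nontangential_le (t : ℂ) : nontangential t ≤ 𝓝[Metric.ball 0 1] t :=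
  iSup₂_le fun _ _ => nhdsWithin_mono _ fun _ hz => hz.1

theorem tendsto_radial {t : ℂ} (ht : ‖t‖ = 1) :
    Tendsto (fun r : ℝ => (r : ℂ) * t) (𝓝[<] 1) (nontangential t) := by
  have h2 : (𝓝[stolzRegion 2 t] t) ≤ nontangential t :=
    le_iSup₂_of_le (f := fun (a : ℝ) (_ : 1 < a) => 𝓝[stolzRegion a t] t) 2 one_lt_two le_rfl
  refine Tendsto.mono_right (tendsto_nhdsWithin_iff.2 ⟨?_, ?_⟩) h2
  · have : Tendsto (fun r : ℝ => (r : ℂ) * t) (𝓝 1) (𝓝 (((1 : ℝ) : ℂ) * t)) :=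
      Continuous.tendsto (by fun_prop) 1
    simp only [Complex.ofReal_one, one_mul] at this
    exact this.mono_left nhdsWithin_le_nhds
  · filter_upwards [eventually_mem_Ioo_nhdsLT_one] with r hr
    refine ⟨ofReal_mul_mem_ball hr ht.le, ?_⟩
    have h1 : t - r * t = ((1 - r : ℝ) : ℂ) * t := by push_cast; ring
    rw [h1, norm_mul, norm_mul, Complex.norm_real, Complex.norm_real, ht,
      Real.norm_of_nonneg (by linarith), Real.norm_of_nonneg hr.1.le]
    linarith

theorem nontangential_neBot {t : ℂ} (ht : ‖t‖ = 1) : (nontangential t).NeBot :=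
  (tendsto_radial ht).neBot

theorem boundaryValue_eq {ω : ℂ → ℂ} {t l : ℂ} (ht : ‖t‖ = 1)
    (h : Tendsto ω (nontangential t) (𝓝 l)) : boundaryValue ω t = l :=
  have := nontangential_neBot ht
  h.limUnder_eq

theorem tendsto_boundaryValue {ω : ℂ → ℂ} {t : ℂ} (h : ∃ l, Tendsto ω (nontangential t) (𝓝 l)) :
    Tendsto ω (nontangential t) (𝓝 (boundaryValue ω t)) :=
  tendsto_nhds_limUnder h

/-! ### Fatou's theorem on nontangential limits -/

/-- A bounded analytic function on the disk has a primitive which is Lipschitz on the plane. -/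
theorem exists_lipschitzWith_primitive {ω : ℂ → ℂ} {C : NNReal}
    (hd : DifferentiableOn ℂ ω (Metric.ball 0 1)) (hb : ∀ z ∈ Metric.ball (0 : ℂ) 1, ‖ω z‖ ≤ C) :
    ∃ (W : ℂ → ℂ) (K : NNReal), LipschitzWith K W ∧
      ∀ z ∈ Metric.ball (0 : ℂ) 1, HasDerivAt W (ω z) z := by
  obtain ⟨V, hV⟩ := hd.isExactOn_ball
  have hl : LipschitzOnWith C V (Metric.ball 0 1) :=
    (convex_ball (0 : ℂ) 1).lipschitzOnWith_of_nnnorm_hasDerivWithin_le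
      (fun x hx => (hV x hx).hasDerivWithinAt) hb
  -- Extending to the plane gives the primitive values on the circle itself.
  obtain ⟨W, hW, hWV⟩ := hl.extend_finite_dimension
  refine ⟨W, _, hW, fun z hz => (hV z hz).congr_of_eventuallyEq ?_⟩
  filter_upwards [Metric.isOpen_ball.mem_nhds hz] with w hw
  exact (hWV hw).symm

theorem hasDerivAt_unitExp (θ : ℝ) : HasDerivAt unitExp (unitExp θ * Complex.I) θ := by
  have h1 : HasDerivAt (fun x : ℝ => (x : ℂ) * Complex.I) (1 * Complex.I) θ :=
    (Complex.ofRealCLM.hasDerivAt (x := θ)).mul_const _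
  have h2 := h1.cexp
  rw [one_mul] at h2
  exact h2

/-- A function on the circle that is differentiable at a point in the angular variable is
differentiable at that point along the circle. -/
theorem exists_circle_derivative {W : ℂ → ℂ} {θ₀ : ℝ}
    (h : DifferentiableAt ℝ (fun θ => W (unitExp θ)) θ₀) :
    ∃ c : ℂ, ∀ ε > 0, ∃ ρ > 0, ∀ w : ℂ, ‖w‖ = 1 → ‖w - unitExp θ₀‖ < ρ →
      ‖W w - W (unitExp θ₀) - c * (w - unitExp θ₀)‖ ≤ ε * ‖w - unitExp θ₀‖ := by
  set t := unitExp θ₀ with ht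
  have ht1 : ‖t‖ = 1 := norm_unitExp θ₀
  have ht0 : t ≠ 0 := unitExp_ne_zero θ₀
  set d := deriv (fun θ => W (unitExp θ)) θ₀
  set c := d / (t * Complex.I)
  have hc : d - c * (t * Complex.I) = 0 := by
    have : t * Complex.I ≠ 0 := mul_ne_zero ht0 Complex.I_ne_zero
    simp only [c]
    field_simp
    ring
  refine ⟨c, fun ε hε => ?_⟩
  have hψ : HasDerivAt (fun θ => W (unitExp θ) - c * unitExp θ) 0 θ₀ := by
    rw [← hc]
    exact h.hasDerivAt.sub ((hasDerivAt_unitExp θ₀).const_mul c)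
  rw [hasDerivAt_iff_isLittleO] at hψ
  -- An arc is at most `π/2` times its chord, so this constant becomes `ε` once the angle is
  -- replaced by `|w - t|`.
  have hψ' := hψ.def (c := ε / (Real.pi / 2)) (by positivity)
  obtain ⟨δ, hδ, hball⟩ := Metric.eventually_nhds_iff.1 hψ'
  refine ⟨δ / (Real.pi / 2), by positivity, fun w hw hwρ => ?_⟩
  have hw0 : w ≠ 0 := norm_ne_zero_iff.1 (by rw [hw]; norm_num)
  set s := (w / t).arg
  have hs : |s| ≤ Real.pi / 2 * ‖w - t‖ := by
    have := Complex.angle_le_mul_norm_sub hw ht1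
    rwa [Complex.angle_eq_abs_arg hw0 ht0] at this
  have hexp : unitExp (θ₀ + s) = w := by
    have h1 : Complex.exp (s * Complex.I) = w / t := by
      have := Complex.norm_mul_exp_arg_mul_I (w / t)
      rwa [norm_div, hw, ht1, div_one, Complex.ofReal_one, one_mul] at this
    have h2 : unitExp (θ₀ + s) = t * Complex.exp (s * Complex.I) := by
      rw [ht, unitExp, unitExp, ← Complex.exp_add]
      push_cast
      ring_nf
    rw [h2, h1]
    field_simp
  have hb := @hball (θ₀ + s) (by
    rw [Real.dist_eq, add_sub_cancel_left]
    refine hs.trans_lt ?_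
    rwa [lt_div_iff₀ (by positivity), mul_comm] at hwρ)
  rw [hexp, ← ht] at hb
  simp only [add_sub_cancel_left, smul_zero, sub_zero] at hb
  have e : W w - W t - c * (w - t) = W w - c * w - (W t - c * t) := by ring
  rw [e]
  refine hb.trans ?_
  rw [Real.norm_eq_abs]
  calc ε / (Real.pi / 2) * |s| ≤ ε / (Real.pi / 2) * (Real.pi / 2 * ‖w - t‖) := by gcongr
    _ = ε * ‖w - t‖ := by field_simp

/-- A bounded analytic function whose boundary values are at most `ε` near a point of the circle
is at most `2 * ε` near that point. -/
theorem HasRadialBoundary.eventually_norm_le {g : ℂ → ℂ} {G : ℝ → ℂ} {C : ℝ}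
    (h : HasRadialBoundary g G C) {t : ℂ} (ht : ‖t‖ = 1) {ε : ℝ} (hε : 0 < ε)
    (hG : ∃ ρ > 0, ∀ θ, ‖unitExp θ - t‖ < ρ → ‖G θ‖ ≤ ε) :
    ∀ᶠ z in 𝓝[Metric.ball 0 1] t, ‖g z‖ ≤ 2 * ε := by
  obtain ⟨ρ, hρ, hG⟩ := hG
  have hC : 0 ≤ C := (norm_nonneg _).trans (h.norm_le 0 (by simp))
  -- Within `ρ` of `t` the boundary values are at most `ε`; elsewhere they are at most `C ≤ C/ρ² |e
  -- - t|²`. The Poisson integral of the sum of both bounds is explicit.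
  have hbound : ∀ z ∈ Metric.ball (0 : ℂ) 1,
      ‖g z‖ ≤ ε + C / ρ ^ 2 * (2 * (1 - z * star t).re) := by
    intro z hz
    have hz' : ‖z‖ < 1 := by simpa using hz
    have hcz := continuous_diskPoisson hz'
    have i2 : Integrable (fun θ => diskPoisson z θ) angleMeasure :=
      Integrable.of_bound hcz.aestronglyMeasurable _ (ae_of_all _ fun θ => by
        simpa using norm_ofReal_diskPoisson_le hz' θ)
    have i3 : Integrable (fun θ => diskPoisson z θ * ‖unitExp θ - t‖ ^ 2) angleMeasure := by
      refine Integrable.of_bound (C := (1 - ‖z‖ ^ 2) / (1 - ‖z‖) ^ 2 * 2 ^ 2)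
        (hcz.mul ((continuous_unitExp.sub continuous_const).norm.pow 2)).aestronglyMeasurable
        (ae_of_all _ fun θ => ?_)
      rw [Real.norm_of_nonneg (mul_nonneg (diskPoisson_nonneg hz' θ) (by positivity))]
      have h2 : ‖unitExp θ - t‖ ≤ 2 := by
        refine (norm_sub_le _ _).trans ?_
        rw [norm_unitExp, ht]; norm_num
      have h3 := diskPoisson_le hz' θ
      have h4 := diskPoisson_nonneg hz' θ
      exact mul_le_mul h3 (by gcongr) (by positivity) (h4.trans h3)
    calc ‖g z‖ = ‖∫ θ, (diskPoisson z θ : ℂ) * G θ ∂angleMeasure‖ := by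
          rw [h.poisson_formula hz']
      _ ≤ ∫ θ, (ε * diskPoisson z θ
            + C / ρ ^ 2 * (diskPoisson z θ * ‖unitExp θ - t‖ ^ 2)) ∂angleMeasure := by
          refine norm_integral_le_of_norm_le ((i2.const_mul _).add (i3.const_mul _)) ?_
          filter_upwards [h.ae_norm_le] with θ hθ
          have hp := diskPoisson_nonneg hz' θ
          rw [norm_mul, Complex.norm_real, Real.norm_of_nonneg hp]
          have : ‖G θ‖ ≤ ε + C / ρ ^ 2 * ‖unitExp θ - t‖ ^ 2 := by
            by_cases hc : ‖unitExp θ - t‖ < ρ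
            · have := hG θ hc
              have : 0 ≤ C / ρ ^ 2 * ‖unitExp θ - t‖ ^ 2 := by positivity
              linarith
            · have h1 : ρ ^ 2 ≤ ‖unitExp θ - t‖ ^ 2 := by gcongr; linarith
              have h2 : C ≤ C / ρ ^ 2 * ‖unitExp θ - t‖ ^ 2 := by
                rw [div_mul_eq_mul_div, le_div_iff₀ (by positivity)]
                gcongr
              linarith
          calc diskPoisson z θ * ‖G θ‖
              ≤ diskPoisson z θ * (ε + C / ρ ^ 2 * ‖unitExp θ - t‖ ^ 2) := by gcongr
            _ = _ := by ring
      _ = _ := by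
          rw [integral_add (i2.const_mul _) (i3.const_mul _), integral_const_mul,
            integral_const_mul, integral_diskPoisson hz', integral_diskPoisson_mul_norm_sq hz' ht,
            mul_one]
  have hlim : Tendsto (fun z : ℂ => ε + C / ρ ^ 2 * (2 * (1 - z * star t).re)) (𝓝 t)
      (𝓝 (ε + C / ρ ^ 2 * (2 * (1 - t * star t).re))) :=
    Continuous.tendsto (by fun_prop) t
  have h0 : t * star t = 1 := by
    have := Complex.mul_conj' t
    simpa [ht] using this
  rw [h0] at hlim
  simp only [sub_self, Complex.zero_re, mul_zero, add_zero] at hlim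
  have hε2 : ε < 2 * ε := by linarith
  have hlim' := hlim.mono_left (nhdsWithin_le_nhds (s := Metric.ball (0 : ℂ) 1))
  have hev := hlim'.eventually_lt_const hε2
  filter_upwards [hev, self_mem_nhdsWithin] with z h1 h2
  exact (hbound z h2).trans h1.le

/-- If the Lipschitz primitive of an analytic function is differentiable along the circle at a
point, then the function has a nontangential limit there. -/
theorem exists_tendsto_nontangential_of_primitive {ω W : ℂ → ℂ} {K : NNReal} {θ₀ : ℝ}
    (hW : LipschitzWith K W) (hd : ∀ z ∈ Metric.ball (0 : ℂ) 1, HasDerivAt W (ω z) z)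
    (h : DifferentiableAt ℝ (fun θ => W (unitExp θ)) θ₀) :
    ∃ l, Tendsto ω (nontangential (unitExp θ₀)) (𝓝 l) := by
  obtain ⟨c, hc⟩ := exists_circle_derivative h
  set t := unitExp θ₀
  have ht : ‖t‖ = 1 := norm_unitExp θ₀
  refine ⟨c, ?_⟩
  set p : ℂ → ℂ := fun w => W w - W t - c * (w - t) with hp
  have hpc : Continuous p := by
    have := hW.continuous
    fun_prop
  have hpd : ∀ z ∈ Metric.ball (0 : ℂ) 1, HasDerivAt p (ω z - c) z := fun z hz => by
    have := ((hd z hz).sub_const (W t)).sub (((hasDerivAt_id z).sub_const t).const_mul c)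
    rw [mul_one] at this
    exact this
  have hpl : ∀ w, ‖p w‖ ≤ (K + ‖c‖) * ‖w - t‖ := fun w => by
    have h1 : ‖W w - W t‖ ≤ K * ‖w - t‖ := by simpa [dist_eq_norm] using hW.dist_le_mul w t
    calc ‖p w‖ ≤ ‖W w - W t‖ + ‖c * (w - t)‖ := norm_sub_le _ _
      _ ≤ _ := by rw [norm_mul]; linarith
  have hne : ∀ w ∈ Metric.ball (0 : ℂ) 1, w - t ≠ 0 := fun w hw h0 => by
    rw [sub_eq_zero.1 h0] at hw
    simp [ht] at hw
  -- The quotient by `w - t` is bounded because `W` is Lipschitz, and small on the circle near `t`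
  -- because `c` is the derivative there. Hence it is small inside the disk too.
  have hq : HasRadialBoundary (fun w => p w / (w - t))
      (fun θ => p (unitExp θ) / (unitExp θ - t)) (K + ‖c‖) := by
    refine ⟨?_, fun z hz => ?_, ?_⟩
    · exact DifferentiableOn.div
        (fun z hz => (hpd z hz).differentiableAt.differentiableWithinAt) (by fun_prop) hne
    · rw [norm_div, div_le_iff₀ (norm_pos_iff.2 (hne z hz))]
      exact hpl z
    · filter_upwards [ae_unitExp_ne t] with θ hθ
      have h1 : Tendsto (fun r : ℝ => (r : ℂ) * unitExp θ) (𝓝[<] 1) (𝓝 (unitExp θ)) :=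
        (tendsto_radial (norm_unitExp θ)).mono_right
          ((nontangential_le _).trans nhdsWithin_le_nhds)
      have h2 : ContinuousAt (fun w => p w / (w - t)) (unitExp θ) :=
        hpc.continuousAt.div (by fun_prop) (sub_ne_zero.2 hθ)
      exact h2.tendsto.comp h1
  rw [tendsto_nontangential_iff]
  intro a ha
  rw [Metric.tendsto_nhds]
  intro η hη
  -- Chosen so that the Cauchy estimate below gives `4ε(a + 1) = η/2`.
  set ε := η / (8 * (a + 1)) with hε
  have hε0 : 0 < ε := by positivity
  have hev := hq.eventually_norm_le ht hε0 (by
    obtain ⟨ρ, hρ, hb⟩ := hc ε hε0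
    refine ⟨ρ, hρ, fun θ hθ => ?_⟩
    by_cases h0 : unitExp θ - t = 0
    · simp [h0, hε0.le]
    · rw [norm_div, div_le_iff₀ (norm_pos_iff.2 h0)]
      exact hb _ (norm_unitExp θ) hθ)
  rw [eventually_nhdsWithin_iff, Metric.eventually_nhds_iff] at hev
  obtain ⟨ρ, hρ, hev⟩ := hev
  rw [eventually_nhdsWithin_iff]
  filter_upwards [Metric.ball_mem_nhds t (show 0 < ρ / (a + 1) by positivity)] with z hzρ hz
  obtain ⟨hzb, hza⟩ := hz
  have hz1 : ‖z‖ < 1 := by simpa using hzb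
  -- The Cauchy estimate for `p' = ω - c` on this circle loses only a constant: in the Stolz region
  -- the distance from `z` to `t` is comparable to `δ`.
  set δ := (1 - ‖z‖) / 2 with hδ
  have hδ0 : 0 < δ := by rw [hδ]; linarith
  have hsub : Metric.closedBall z δ ⊆ Metric.ball 0 1 := by
    intro w hw
    rw [mem_closedBall_iff_norm] at hw
    rw [mem_ball_zero_iff]
    have : ‖w‖ ≤ ‖w - z‖ + ‖z‖ := by simpa using norm_add_le (w - z) z
    linarith
  have hder : ‖deriv p z‖ ≤ 2 * ε * (2 * (a + 1) * δ) / δ := by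
    refine Complex.norm_deriv_le_of_forall_mem_sphere_norm_le hδ0 ?_ fun w hw => ?_
    · refine DifferentiableOn.diffContOnCl fun w hw => ?_
      rw [closure_ball _ hδ0.ne'] at hw
      exact (hpd w (hsub hw)).differentiableAt.differentiableWithinAt
    · have hwb := hsub (Metric.sphere_subset_closedBall hw)
      have hwz : ‖w - z‖ = δ := by simpa using hw
      have htz : ‖z - t‖ = ‖t - z‖ := norm_sub_rev _ _
      have h3 : ‖w - t‖ ≤ δ + ‖t - z‖ := by
        rw [← hwz, ← htz]
        simpa using norm_add_le (w - z) (z - t)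
      have h4 : 1 - ‖z‖ ≤ ‖t - z‖ := by simpa [ht] using norm_sub_norm_le t z
      have h5 : ‖t - z‖ * (a + 1) < ρ := by
        rw [Metric.mem_ball, dist_eq_norm, htz, lt_div_iff₀ (by positivity)] at hzρ
        exact hzρ
      have h6 : ‖w - t‖ < ρ := by nlinarith [norm_nonneg (t - z)]
      have h7 := hev (by rw [dist_eq_norm]; exact h6) hwb
      rw [norm_div, div_le_iff₀ (norm_pos_iff.2 (hne w hwb))] at h7
      refine h7.trans ?_
      have : ‖w - t‖ ≤ 2 * (a + 1) * δ := by nlinarith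
      gcongr
  rw [(hpd z hzb).deriv] at hder
  rw [dist_eq_norm]
  refine hder.trans_lt ?_
  have : 2 * ε * (2 * (a + 1) * δ) / δ = η / 2 := by
    rw [hε]; field_simp; ring
  linarith

/-- **Fatou's theorem**: a bounded analytic function on the disk has nontangential limits almost
everywhere on the circle. -/
theorem ae_exists_tendsto_nontangential {ω : ℂ → ℂ} {C : NNReal}
    (hd : DifferentiableOn ℂ ω (Metric.ball 0 1)) (hb : ∀ z ∈ Metric.ball (0 : ℂ) 1, ‖ω z‖ ≤ C) :
    ∀ᵐ θ ∂angleMeasure, ∃ l, Tendsto ω (nontangential (unitExp θ)) (𝓝 l) := by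
  obtain ⟨W, K, hW, hWd⟩ := exists_lipschitzWith_primitive hd hb
  have hexp : LipschitzWith 1 unitExp :=
    lipschitzWith_of_nnnorm_deriv_le (fun θ => (hasDerivAt_unitExp θ).differentiableAt)
      fun θ => by
        rw [(hasDerivAt_unitExp θ).deriv, ← NNReal.coe_le_coe]
        simp
  apply ae_angleMeasure_of_ae
  filter_upwards [(hW.comp hexp).ae_differentiableAt_real] with θ hθ
  exact exists_tendsto_nontangential_of_primitive hW hWd hθ

theorem IsSchur.hasRadialBoundary {ω : ℂ → ℂ} (hω : IsSchur ω) :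
    HasRadialBoundary ω (fun θ => boundaryValue ω (unitExp θ)) 1 := by
  refine ⟨hω.1, hω.2, ?_⟩
  filter_upwards [ae_exists_tendsto_nontangential (C := 1) hω.1 (by simpa using hω.2)] with θ hθ
  exact (tendsto_boundaryValue hθ).comp (tendsto_radial (norm_unitExp θ))

/-! ### The Schwarz-Pick inequality -/

theorem norm_one_sub_star_mul_sq (a z : ℂ) :
    ‖1 - star a * z‖ ^ 2 = ‖a - z‖ ^ 2 + (1 - ‖a‖ ^ 2) * (1 - ‖z‖ ^ 2) := by
  simp only [← Complex.normSq_eq_norm_sq, Complex.normSq_apply]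
  simp
  ring

theorem one_sub_star_mul_ne_zero {a z : ℂ} (ha : ‖a‖ < 1) (hz : ‖z‖ ≤ 1) :
    1 - star a * z ≠ 0 := by
  intro h
  have h1 : ‖star a * z‖ = 1 := by rw [← sub_eq_zero.1 h, norm_one]
  rw [norm_mul, norm_star] at h1
  nlinarith [norm_nonneg a, norm_nonneg z]

theorem norm_mobius_le_one {a z : ℂ} (ha : ‖a‖ < 1) (hz : ‖z‖ ≤ 1) :
    ‖(a - z) / (1 - star a * z)‖ ≤ 1 := by
  rw [norm_div, div_le_one (norm_pos_iff.2 (one_sub_star_mul_ne_zero ha hz))]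
  have h1 := norm_one_sub_star_mul_sq a z
  have h2 : 0 ≤ (1 - ‖a‖ ^ 2) * (1 - ‖z‖ ^ 2) :=
    mul_nonneg (by nlinarith [norm_nonneg a]) (by nlinarith [norm_nonneg z])
  exact le_of_sq_le_sq (by linarith) (norm_nonneg _)

theorem norm_mobius_lt_one {a z : ℂ} (ha : ‖a‖ < 1) (hz : ‖z‖ < 1) :
    ‖(a - z) / (1 - star a * z)‖ < 1 := by
  rw [norm_div, div_lt_one (norm_pos_iff.2 (one_sub_star_mul_ne_zero ha hz.le))]
  have h1 := norm_one_sub_star_mul_sq a z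
  have h2 : 0 < (1 - ‖a‖ ^ 2) * (1 - ‖z‖ ^ 2) :=
    mul_pos (by nlinarith [norm_nonneg a]) (by nlinarith [norm_nonneg z])
  exact lt_of_pow_lt_pow_left₀ 2 (norm_nonneg _) (by linarith)

theorem mobius_mobius {a z : ℂ} (ha : ‖a‖ < 1) (hz : ‖z‖ < 1) :
    (a - (a - z) / (1 - star a * z)) / (1 - star a * ((a - z) / (1 - star a * z))) = z := by
  have h1 := one_sub_star_mul_ne_zero ha hz.le
  have h3 := one_sub_star_mul_ne_zero ha (norm_mobius_lt_one ha hz).le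
  rw [div_eq_iff h3]
  generalize star a = s at *
  set D := 1 - s * z with hD
  field_simp
  rw [hD]
  ring

theorem differentiableOn_mobius {a : ℂ} (ha : ‖a‖ < 1) :
    DifferentiableOn ℂ (fun z => (a - z) / (1 - star a * z)) (Metric.closedBall 0 1) :=
  DifferentiableOn.div (by fun_prop) (by fun_prop) fun z hz =>
    one_sub_star_mul_ne_zero ha (by simpa using hz)

/-- The **Schwarz-Pick inequality** for functions with values in the open disk. -/
theorem schwarz_pick_of_norm_lt_one {g : ℂ → ℂ} (hd : DifferentiableOn ℂ g (Metric.ball 0 1))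
    (hb : ∀ z ∈ Metric.ball (0 : ℂ) 1, ‖g z‖ < 1) {w z : ℂ} (hw : ‖w‖ < 1) (hz : ‖z‖ < 1) :
    ‖1 - star (g w) * g z‖ ^ 2 * ((1 - ‖w‖ ^ 2) * (1 - ‖z‖ ^ 2)) ≤
      (1 - ‖g w‖ ^ 2) * (1 - ‖g z‖ ^ 2) * ‖1 - star w * z‖ ^ 2 := by
  have ha : ‖g w‖ < 1 := hb w (by simpa using hw)
  have hgz : ‖g z‖ < 1 := hb z (by simpa using hz)
  have hm : Set.MapsTo (fun z => (w - z) / (1 - star w * z)) (Metric.ball 0 1)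
      (Metric.ball 0 1) := fun x hx => by
    simpa using norm_mobius_lt_one hw (by simpa using hx : ‖x‖ < 1)
  have hcomp : DifferentiableOn ℂ (fun ζ => g ((w - ζ) / (1 - star w * ζ))) (Metric.ball 0 1) :=
    hd.comp ((differentiableOn_mobius hw).mono Metric.ball_subset_closedBall) hm
  -- Schwarz's lemma for `g` conjugated by the disk involutions exchanging 0 with `w` and with `g
  -- w`, evaluated at the image of `z`.
  have key := Complex.norm_le_norm_of_mapsTo_ball
    (f := fun ζ => (g w - g ((w - ζ) / (1 - star w * ζ)))
      / (1 - star (g w) * g ((w - ζ) / (1 - star w * ζ))))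
    (z := (w - z) / (1 - star w * z)) (R := 1)
    ((differentiableOn_mobius ha).comp hcomp fun x hx => by
      simpa using (hb _ (hm hx)).le)
    (fun x hx => by simpa using norm_mobius_le_one ha (hb _ (hm hx)).le)
    (by simp) (norm_mobius_lt_one hw hz)
  simp only [mobius_mobius hw hz] at key
  have p1 := norm_pos_iff.2 (one_sub_star_mul_ne_zero ha hgz.le)
  have p2 := norm_pos_iff.2 (one_sub_star_mul_ne_zero hw hz.le)
  rw [norm_div, norm_div, div_le_div_iff₀ p1 p2] at key
  have key2 := pow_le_pow_left₀ (by positivity) key 2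
  rw [mul_pow, mul_pow] at key2
  have e1 := norm_one_sub_star_mul_sq (g w) (g z)
  have e2 := norm_one_sub_star_mul_sq w z
  have e3 : ‖g w - g z‖ ^ 2 = ‖1 - star (g w) * g z‖ ^ 2 - (1 - ‖g w‖ ^ 2) * (1 - ‖g z‖ ^ 2) := by
    linarith
  have e4 : ‖w - z‖ ^ 2 = ‖1 - star w * z‖ ^ 2 - (1 - ‖w‖ ^ 2) * (1 - ‖z‖ ^ 2) := by linarith
  rw [e3, e4] at key2
  linarith

/-- The **Schwarz-Pick inequality** for Schur functions. -/
theorem IsSchur.schwarz_pick {ω : ℂ → ℂ} (hω : IsSchur ω) {w z : ℂ} (hw : ‖w‖ < 1)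
    (hz : ‖z‖ < 1) :
    ‖1 - star (ω w) * ω z‖ ^ 2 * ((1 - ‖w‖ ^ 2) * (1 - ‖z‖ ^ 2)) ≤
      (1 - ‖ω w‖ ^ 2) * (1 - ‖ω z‖ ^ 2) * ‖1 - star w * z‖ ^ 2 := by
  -- For `s < 1` the function `s * ω` maps into the open disk. The inequality contains no division
  -- by `1 - |ω|²`, so it survives `s → 1`, even for unimodular constants.
  have h1 : Continuous fun s : ℝ =>
      ‖1 - star (s * ω w) * (s * ω z)‖ ^ 2 * ((1 - ‖w‖ ^ 2) * (1 - ‖z‖ ^ 2)) := by fun_prop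
  have h2 : Continuous fun s : ℝ =>
      (1 - ‖s * ω w‖ ^ 2) * (1 - ‖s * ω z‖ ^ 2) * ‖1 - star w * z‖ ^ 2 := by fun_prop
  have := le_of_tendsto_of_tendsto ((h1.tendsto 1).mono_left (nhdsWithin_le_nhds (s := Set.Iio 1)))
    ((h2.tendsto 1).mono_left nhdsWithin_le_nhds) (by
      filter_upwards [eventually_mem_Ioo_nhdsLT_one] with s hs
      refine schwarz_pick_of_norm_lt_one (g := fun z => s * ω z) (hω.1.const_mul _)
        (fun x hx => ?_) hw hz
      rw [norm_mul, Complex.norm_real, Real.norm_of_nonneg hs.1.le]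
      nlinarith [hω.2 x hx, norm_nonneg (ω x)])
  simpa using this

/-! ### Julia's lemma -/

theorem norm_one_sub_mul_star {t : ℂ} (ht : ‖t‖ = 1) (z : ℂ) :
    ‖1 - z * star t‖ = ‖t - z‖ := by
  have h : t * star t = 1 := by
    have := Complex.mul_conj' t
    simpa [ht] using this
  rw [← h, ← sub_mul, norm_mul, norm_star, ht, mul_one]

theorem one_sub_norm_sq_le {b v : ℂ} (hb : ‖b‖ = 1) (hv : ‖v‖ ≤ 1) :
    1 - ‖v‖ ^ 2 ≤ 2 * ‖1 - v * star b‖ := by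
  have h1 : 1 - ‖v‖ ≤ ‖1 - v * star b‖ := by
    rw [norm_one_sub_mul_star hb, ← hb]
    exact norm_sub_norm_le b v
  nlinarith [norm_nonneg v]

/-- **Julia's lemma**: if `(1 - |ω|²) / (1 - |z|²)` has a finite lower limit at `t`, then `ω`
satisfies Julia's inequality at `t` with some unimodular value. -/
theorem IsSchur.julia {ω : ℂ → ℂ} (hω : IsSchur ω) {t : ℂ} (ht : ‖t‖ = 1)
    (h : juliaLiminf ω t < ⊤) :
    ∃ (b : ℂ) (M : ℝ), ‖b‖ = 1 ∧ 0 ≤ M ∧ ∀ z ∈ Metric.ball (0 : ℂ) 1,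
      ‖1 - ω z * star b‖ * (1 - ‖z‖ ^ 2) ≤ M * ‖1 - z * star t‖ ^ 2 := by
  obtain ⟨M, hM, -⟩ := EReal.lt_iff_exists_real_btwn.1 h
  have hfr : ∃ᶠ w in 𝓝[Metric.ball (0 : ℂ) 1] t, (1 - ‖ω w‖ ^ 2) / (1 - ‖w‖ ^ 2) < M :=
    (frequently_lt_of_liminf_lt (by isBoundedDefault) hM).mono fun w hw => by exact_mod_cast hw
  set F := 𝓝[Metric.ball (0 : ℂ) 1] t ⊓ 𝓟 {w | (1 - ‖ω w‖ ^ 2) / (1 - ‖w‖ ^ 2) < M}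
  have : F.NeBot := frequently_iff_neBot.1 hfr
  -- An ultrafilter replaces passage to a subsequence: along `U` the quotient stays below `M`, `w →
  -- t`, and `ω w` converges by compactness of the closed disk.
  set U := Ultrafilter.of F
  have hUF : (U : Filter ℂ) ≤ F := Ultrafilter.of_le F
  have hUb : ∀ᶠ w in (U : Filter ℂ), ‖w‖ < 1 := by
    refine (hUF.trans inf_le_left) ?_
    filter_upwards [self_mem_nhdsWithin] with w hw
    simpa using hw
  have hUM : ∀ᶠ w in (U : Filter ℂ), 1 - ‖ω w‖ ^ 2 ≤ M * (1 - ‖w‖ ^ 2) := by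
    have h1 : ∀ᶠ w in (U : Filter ℂ), (1 - ‖ω w‖ ^ 2) / (1 - ‖w‖ ^ 2) < M :=
      (hUF.trans inf_le_right) (mem_principal_self _)
    filter_upwards [h1, hUb] with w hw hw1
    have : 0 < 1 - ‖w‖ ^ 2 := by nlinarith [norm_nonneg w]
    exact ((div_lt_iff₀ this).1 hw).le
  have hUt : Tendsto (fun w : ℂ => w) U (𝓝 t) :=
    (hUF.trans inf_le_left).trans nhdsWithin_le_nhds
  have hUω : ∀ᶠ w in (U : Filter ℂ), ‖ω w‖ ≤ 1 := by
    filter_upwards [hUb] with w hw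
    exact hω.2 w (by simpa using hw)
  obtain ⟨b, -, hb⟩ := (isCompact_closedBall (0 : ℂ) 1).ultrafilter_le_nhds (U.map ω) (by
    rw [le_principal_iff]
    exact hUω.mono fun w hw => by simpa using hw)
  have hb : Tendsto ω U (𝓝 b) := hb
  have hM0 : 0 ≤ M := by
    obtain ⟨w, h1, h2, h3⟩ := (hUM.and (hUb.and hUω)).exists
    by_contra! hneg
    have h4 : 0 < 1 - ‖w‖ ^ 2 := by nlinarith [norm_nonneg w]
    have h5 : 0 ≤ 1 - ‖ω w‖ ^ 2 := by nlinarith [norm_nonneg (ω w)]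
    nlinarith
  have hb1 : ‖b‖ = 1 := by
    have l1 : Tendsto (fun w => 1 - ‖ω w‖ ^ 2) U (𝓝 (1 - ‖b‖ ^ 2)) :=
      (hb.norm.pow 2).const_sub 1
    have l2 : Tendsto (fun w => M * (1 - ‖w‖ ^ 2)) (U : Filter ℂ)
        (𝓝 (M * (1 - ‖t‖ ^ 2))) :=
      ((hUt.norm.pow 2).const_sub 1).const_mul M
    have h1 := le_of_tendsto_of_tendsto l1 l2 hUM
    have h2 := le_of_tendsto hb.norm hUω
    rw [ht] at h1
    nlinarith [norm_nonneg b]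
  refine ⟨b, 2 * M, hb1, by positivity, fun z hz => ?_⟩
  have hz1 : ‖z‖ < 1 := by simpa using hz
  -- Schwarz-Pick for the pair `w`, `z`, divided by `1 - |w|²`, in the limit along `U`.
  have hlim : ‖1 - star b * ω z‖ ^ 2 * (1 - ‖z‖ ^ 2) ≤
      M * (1 - ‖ω z‖ ^ 2) * ‖1 - star t * z‖ ^ 2 := by
    have l1 : Tendsto (fun w => ‖1 - star (ω w) * ω z‖ ^ 2 * (1 - ‖z‖ ^ 2)) U
        (𝓝 (‖1 - star b * ω z‖ ^ 2 * (1 - ‖z‖ ^ 2))) :=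
      (((hb.star.mul_const _).const_sub 1).norm.pow 2).mul_const _
    have l2 : Tendsto (fun w => M * (1 - ‖ω z‖ ^ 2) * ‖1 - star w * z‖ ^ 2) U
        (𝓝 (M * (1 - ‖ω z‖ ^ 2) * ‖1 - star t * z‖ ^ 2)) :=
      (((hUt.star.mul_const _).const_sub 1).norm.pow 2).const_mul _
    refine le_of_tendsto_of_tendsto l1 l2 ?_
    filter_upwards [hUM, hUb] with w h1 h2
    have h3 : 0 < 1 - ‖w‖ ^ 2 := by nlinarith [norm_nonneg w]
    have h4 : 0 ≤ 1 - ‖ω z‖ ^ 2 := by nlinarith [norm_nonneg (ω z), hω.2 z hz]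
    refine le_of_mul_le_mul_left ?_ h3
    have h5 := hω.schwarz_pick h2 hz1
    have h6 : (1 - ‖ω w‖ ^ 2) * ((1 - ‖ω z‖ ^ 2) * ‖1 - star w * z‖ ^ 2) ≤
      M * (1 - ‖w‖ ^ 2) * ((1 - ‖ω z‖ ^ 2) * ‖1 - star w * z‖ ^ 2) := by gcongr
    linarith
  rw [mul_comm (star b), mul_comm (star t)] at hlim
  -- This bound allows one factor `|1 - ω b*|` to be cancelled, which doubles the constant.
  have h7 := one_sub_norm_sq_le hb1 (hω.2 z hz)
  rcases (norm_nonneg (1 - ω z * star b)).eq_or_lt with h0 | h0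
  · rw [← h0, zero_mul]
    positivity
  · refine le_of_mul_le_mul_left ?_ h0
    calc _ = ‖1 - ω z * star b‖ ^ 2 * (1 - ‖z‖ ^ 2) := by ring
      _ ≤ M * (1 - ‖ω z‖ ^ 2) * ‖1 - z * star t‖ ^ 2 := hlim
      _ ≤ M * (2 * ‖1 - ω z * star b‖) * ‖1 - z * star t‖ ^ 2 := by gcongr
      _ = _ := by ring

theorem tendsto_of_tendsto_one_sub_mul_star {α : Type*} {l : Filter α} {f : α → ℂ} {b : ℂ}
    (hb : ‖b‖ = 1) (h : Tendsto (fun x => 1 - f x * star b) l (𝓝 0)) : Tendsto f l (𝓝 b) := by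
  have h1 : star b * b = 1 := by
    have := Complex.conj_mul' b
    simpa [hb] using this
  have h2 := (h.const_sub 1).mul_const b
  simpa only [mul_assoc, sub_sub_cancel, sub_zero, h1, mul_one, one_mul] using h2

/-- Julia's inequality implies the existence of the nontangential limit. -/
theorem tendsto_nontangential_of_julia_inequality {ω : ℂ → ℂ} {t b : ℂ} {M : ℝ} (ht : ‖t‖ = 1)
    (hb : ‖b‖ = 1) (hM : 0 ≤ M) (h : ∀ z ∈ Metric.ball (0 : ℂ) 1,
      ‖1 - ω z * star b‖ * (1 - ‖z‖ ^ 2) ≤ M * ‖1 - z * star t‖ ^ 2) :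
    Tendsto ω (nontangential t) (𝓝 b) := by
  refine tendsto_of_tendsto_one_sub_mul_star hb (tendsto_nontangential_iff.2 fun a ha => ?_)
  have h0 : Tendsto (fun z : ℂ => M * a * ‖t - z‖) (𝓝[stolzRegion a t] t) (𝓝 0) := by
    have : Tendsto (fun z : ℂ => M * a * ‖t - z‖) (𝓝 t) (𝓝 (M * a * ‖t - t‖)) :=
      Continuous.tendsto (by fun_prop) t
    simp only [sub_self, norm_zero, mul_zero] at this
    exact this.mono_left nhdsWithin_le_nhds
  refine squeeze_zero_norm' ?_ h0
  filter_upwards [self_mem_nhdsWithin] with z hz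
  obtain ⟨hzb, hza⟩ := hz
  have hz1 : ‖z‖ < 1 := by simpa using hzb
  have h1 := h z hzb
  rw [norm_one_sub_mul_star ht] at h1
  have h2 : 1 - ‖z‖ ≤ 1 - ‖z‖ ^ 2 := by nlinarith [norm_nonneg z]
  have h3 : 0 < 1 - ‖z‖ := by linarith
  refine le_of_mul_le_mul_right ?_ h3
  calc ‖1 - ω z * star b‖ * (1 - ‖z‖) ≤ ‖1 - ω z * star b‖ * (1 - ‖z‖ ^ 2) := by gcongr
    _ ≤ M * ‖t - z‖ * ‖t - z‖ := by linarith
    _ ≤ M * ‖t - z‖ * (a * (1 - ‖z‖)) := by gcongr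
    _ = _ := by ring

/-! ### Integral representation at a boundary point, and lower semicontinuity -/

section

variable {f : ℂ → ℂ} {F : ℝ → ℂ} {C : ℝ} {t : ℂ}

theorem norm_unitExp_sub_sq_eq (t : ℂ) (θ : ℝ) :
    ((‖unitExp θ - t‖ ^ 2 : ℝ) : ℂ) = (unitExp θ - t) * star (unitExp θ - t) := by
  push_cast
  exact (Complex.mul_conj' _).symm

theorem aestronglyMeasurable_cauchy_quotient (t z : ℂ) :
    AEStronglyMeasurable (fun θ => (unitExp θ - t) / (unitExp θ - z)) angleMeasure :=
  ((continuous_unitExp.measurable.sub_const t).div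
    (continuous_unitExp.measurable.sub_const z)).aestronglyMeasurable

/-- In the Stolz region `|t - z| < a(1 - |z|) ≤ a|e - z|`; the triangle inequality does the rest.
This domination is what requires nontangential approach. -/
theorem norm_cauchy_quotient_le {a : ℝ} {z : ℂ} (hz : z ∈ stolzRegion a t) (θ : ℝ) :
    ‖(unitExp θ - t) / (unitExp θ - z)‖ ≤ 1 + a := by
  obtain ⟨hzb, hza⟩ := hz
  have hz1 : ‖z‖ < 1 := by simpa using hzb
  have h1 := one_sub_norm_le_norm_unitExp_sub z θ
  rw [norm_div, div_le_iff₀ (norm_pos_iff.2 (unitExp_sub_ne_zero hz1 θ))]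
  have h2 : ‖unitExp θ - t‖ ≤ ‖unitExp θ - z‖ + ‖t - z‖ := by
    have := norm_sub_le (unitExp θ - z) (t - z)
    rwa [sub_sub_sub_cancel_right] at this
  have h3 : 0 < a := by
    by_contra! hn
    nlinarith [norm_nonneg (t - z)]
  nlinarith

theorem tendsto_integral_cauchy_quotient {H : ℝ → ℝ} (hH : Integrable H angleMeasure) (a : ℝ) :
    Tendsto (fun z => ∫ θ, (unitExp θ - t) / (unitExp θ - z) * (H θ : ℂ) ∂angleMeasure)
      (𝓝[stolzRegion a t] t) (𝓝 ((∫ θ, H θ ∂angleMeasure : ℝ) : ℂ)) := by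
  have hH' : Integrable (fun θ => (H θ : ℂ)) angleMeasure := hH.ofReal
  rw [← integral_complex_ofReal]
  refine tendsto_integral_filter_of_dominated_convergence (fun θ => (1 + a) * ‖H θ‖)
    (Eventually.of_forall fun z =>
      (aestronglyMeasurable_cauchy_quotient t z).mul hH'.aestronglyMeasurable) ?_
    (hH.norm.const_mul _) ?_
  · filter_upwards [self_mem_nhdsWithin] with z hz
    filter_upwards with θ
    rw [norm_mul, Complex.norm_real]
    gcongr
    exact norm_cauchy_quotient_le hz θ
  · filter_upwards [ae_unitExp_ne t] with θ hθ
    have h0 : unitExp θ - t ≠ 0 := sub_ne_zero.2 hθ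
    have h1 : ContinuousAt (fun z => (unitExp θ - t) / (unitExp θ - z) * (H θ : ℂ)) t := by
      fun_prop (disch := exact h0)
    have h2 := h1.tendsto.mono_left (nhdsWithin_le_nhds (s := stolzRegion a t))
    simpa [div_self h0] using h2

theorem integrable_cauchy_quotient {H : ℝ → ℝ} (hH : Integrable H angleMeasure) {z : ℂ}
    (hz : ‖z‖ < 1) :
    Integrable (fun θ => (unitExp θ - t) / (unitExp θ - z) * (H θ : ℂ)) angleMeasure := by
  -- A single point lies in a region of sufficiently large aperture, so the same kernel bound
  -- applies.
  have hz' : z ∈ stolzRegion ((‖t - z‖ + 1) / (1 - ‖z‖)) t := by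
    refine ⟨by simpa using hz, ?_⟩
    rw [div_mul_cancel₀ _ (by linarith)]
    linarith
  exact hH.ofReal.bdd_mul (aestronglyMeasurable_cauchy_quotient t z)
    (ae_of_all _ fun θ => norm_cauchy_quotient_le hz' θ)

/-- The integral representation of `f / (1 - z t*)`, up to the boundary value of `f` at `t`. -/
theorem HasRadialBoundary.exists_eq_add_mul_integral (h : HasRadialBoundary f F C) (ht : ‖t‖ = 1)
    (hH : Integrable (fun θ => 2 * (F θ).re / ‖unitExp θ - t‖ ^ 2) angleMeasure) :
    ∃ c : ℂ, c.re = 0 ∧ ∀ z : ℂ, ‖z‖ < 1 → f z = c + (1 - z * star t) *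
      ∫ θ, (unitExp θ - t) / (unitExp θ - z) *
        ((2 * (F θ).re / ‖unitExp θ - t‖ ^ 2 : ℝ) : ℂ) ∂angleMeasure := by
  set H : ℝ → ℝ := fun θ => 2 * (F θ).re / ‖unitExp θ - t‖ ^ 2 with hHdef
  have htt : t * star t = 1 := by
    have := Complex.mul_conj' t
    simpa [ht] using this
  have i0 : Integrable (fun θ => (1 - unitExp θ * star t) * (H θ : ℂ)) angleMeasure := by
    refine hH.ofReal.bdd_mul (c := 2) (Continuous.aestronglyMeasurable (by
      have := continuous_unitExp
      fun_prop)) (ae_of_all _ fun θ => ?_)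
    refine (norm_sub_le _ _).trans ?_
    rw [norm_mul, norm_unitExp, norm_star, ht]
    norm_num
  refine ⟨(∫ θ, (1 - unitExp θ * star t) * (H θ : ℂ) ∂angleMeasure) - star (f 0), ?_,
    fun z hz => ?_⟩
  -- As `|e - t|² = 2 Re(1 - e t*)`, the real part of the first integral is the mean of `Re F`, that
  -- is `Re f(0)`.
  · have e1 : (∫ θ, (1 - unitExp θ * star t) * (H θ : ℂ) ∂angleMeasure).re
        = ∫ θ, (F θ).re ∂angleMeasure := by
      have := integral_re i0
      simp only [RCLike.re_to_complex] at this
      rw [← this]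
      refine integral_congr_ae ?_
      filter_upwards [ae_unitExp_ne t] with θ hθ
      have h0 : ‖unitExp θ - t‖ ^ 2 ≠ 0 := pow_ne_zero _ (norm_ne_zero_iff.2 (sub_ne_zero.2 hθ))
      rw [Complex.re_mul_ofReal, hHdef]
      have h1 := norm_unitExp_sub_sq ht θ
      simp only
      rw [h1] at h0 ⊢
      have h2 := (mul_ne_zero_iff.1 h0).2
      field_simp
    have e2 : ∫ θ, (F θ).re ∂angleMeasure = (f 0).re := by
      rw [← h.re_poisson_formula (z := 0) (by simp)]
      simp [diskPoisson]
    rw [Complex.sub_re, e1, e2, Complex.star_def, Complex.conj_re, sub_self]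
  · have hF : Integrable (fun θ => unitExp θ / (unitExp θ - z) * F θ) angleMeasure :=
      h.integrable_mul (continuous_div_unitExp_sub hz) (norm_div_unitExp_sub_le hz)
    have hFs : Integrable (fun θ => unitExp θ / (unitExp θ - z) * star (F θ)) angleMeasure := by
      refine Integrable.of_bound (C := 1 / (1 - ‖z‖) * C)
        ((continuous_div_unitExp_sub hz).aestronglyMeasurable.mul
          (continuous_star.comp_aestronglyMeasurable h.aestronglyMeasurable)) ?_
      filter_upwards [h.ae_norm_le] with θ hθ
      rw [norm_mul, norm_star]
      have := norm_div_unitExp_sub_le hz θ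
      exact mul_le_mul this hθ (norm_nonneg _) ((norm_nonneg _).trans this)
    -- Pointwise this is the identity `|e - t|² e/(e - z) = (1 - e t*) + (1 - z t*)(e - t)/(e - z)`,
    -- multiplied by `H`.
    have e : f z + star (f 0) = (∫ θ, (1 - unitExp θ * star t) * (H θ : ℂ) ∂angleMeasure)
        + (1 - z * star t) *
          ∫ θ, (unitExp θ - t) / (unitExp θ - z) * (H θ : ℂ) ∂angleMeasure := by
      rw [← h.cauchy_formula hz, ← h.cauchy_formula_star hz, ← integral_add hF hFs,
        ← integral_const_mul,
        ← integral_add i0 ((integrable_cauchy_quotient hH hz).const_mul _)]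
      refine integral_congr_ae ?_
      filter_upwards [ae_unitExp_ne t] with θ hθ
      have h0 : unitExp θ - t ≠ 0 := sub_ne_zero.2 hθ
      have h0' : star (unitExp θ - t) ≠ 0 := star_ne_zero.2 h0
      have hz0 := unitExp_sub_ne_zero hz θ
      have hre : F θ + star (F θ) = ((2 * (F θ).re : ℝ) : ℂ) := by
        have := Complex.add_conj (F θ)
        exact_mod_cast this
      have huu : unitExp θ * star (unitExp θ) = 1 := by
        have := Complex.mul_conj' (unitExp θ)
        simpa using this
      rw [← mul_add, hre, hHdef]
      simp only
      rw [Complex.ofReal_div, norm_unitExp_sub_sq_eq]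
      generalize ((2 * (F θ).re : ℝ) : ℂ) = R
      field_simp
      rw [star_sub]
      generalize unitExp θ = e at *
      generalize hs : star t = s at *
      generalize hu : star e = u at *
      linear_combination R * (e - t) * huu + R * (e - z) * htt
    linear_combination e

/-- The angular derivative as an integral over the circle. -/
theorem HasRadialBoundary.eq_mul_integral (h : HasRadialBoundary f F C) (ht : ‖t‖ = 1)
    (hf : ∀ z ∈ Metric.ball (0 : ℂ) 1, ‖1 - f z‖ ≤ 1)
    (hH : Integrable (fun θ => 2 * (F θ).re / ‖unitExp θ - t‖ ^ 2) angleMeasure) {z : ℂ}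
    (hz : ‖z‖ < 1) :
    f z = (1 - z * star t) * ∫ θ, (unitExp θ - t) / (unitExp θ - z) *
        ((2 * (F θ).re / ‖unitExp θ - t‖ ^ 2 : ℝ) : ℂ) ∂angleMeasure := by
  obtain ⟨c, hc, hrep⟩ := h.exists_eq_add_mul_integral ht hH
  have htt : t * star t = 1 := by
    have := Complex.mul_conj' t
    simpa [ht] using this
  have l1 : Tendsto (fun z : ℂ => c + (1 - z * star t) *
      ∫ θ, (unitExp θ - t) / (unitExp θ - z) *
        ((2 * (F θ).re / ‖unitExp θ - t‖ ^ 2 : ℝ) : ℂ) ∂angleMeasure)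
      (nontangential t) (𝓝 c) := by
    refine tendsto_nontangential_iff.2 fun a _ => ?_
    have h1 : Tendsto (fun z : ℂ => 1 - z * star t) (𝓝[stolzRegion a t] t) (𝓝 0) := by
      have : Tendsto (fun z : ℂ => 1 - z * star t) (𝓝 t) (𝓝 (1 - t * star t)) :=
        Continuous.tendsto (by fun_prop) t
      rw [htt, sub_self] at this
      exact this.mono_left nhdsWithin_le_nhds
    simpa using (h1.mul (tendsto_integral_cauchy_quotient hH a)).const_add c
  have := nontangential_neBot ht
  have hb : ∀ᶠ z in nontangential t, z ∈ Metric.ball (0 : ℂ) 1 :=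
    nontangential_le t self_mem_nhdsWithin
  -- The representation shows that `f` tends to `c`. The closed disk of radius 1 about 1 meets the
  -- imaginary axis only at 0.
  have hc1 : ‖1 - c‖ ≤ 1 := by
    refine le_of_tendsto (l1.const_sub 1).norm ?_
    filter_upwards [hb] with z hz
    rw [← hrep z (by simpa using hz)]
    exact hf z hz
  have hc0 : c = 0 := by
    have h2 : ‖1 - c‖ ^ 2 ≤ 1 := by nlinarith [norm_nonneg (1 - c)]
    rw [← Complex.normSq_eq_norm_sq, Complex.normSq_apply] at h2
    simp only [Complex.sub_re, Complex.one_re, hc, Complex.sub_im, Complex.one_im] at h2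
    apply Complex.ext
    · simpa using hc
    · have : c.im * c.im ≤ 0 := by nlinarith
      simpa using mul_self_eq_zero.1 (le_antisymm this (mul_self_nonneg _))
  rw [hrep z hz, hc0, zero_add]

theorem HasRadialBoundary.tendsto_div (h : HasRadialBoundary f F C) (ht : ‖t‖ = 1)
    (hf : ∀ z ∈ Metric.ball (0 : ℂ) 1, ‖1 - f z‖ ≤ 1)
    (hH : Integrable (fun θ => 2 * (F θ).re / ‖unitExp θ - t‖ ^ 2) angleMeasure) :
    Tendsto (fun z => f z / (1 - z * star t)) (nontangential t)
      (𝓝 ((∫ θ, 2 * (F θ).re / ‖unitExp θ - t‖ ^ 2 ∂angleMeasure : ℝ) : ℂ)) := by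
  refine tendsto_nontangential_iff.2 fun a _ => (tendsto_integral_cauchy_quotient hH a).congr' ?_
  filter_upwards [self_mem_nhdsWithin] with z hz
  have hz1 : ‖z‖ < 1 := by simpa using hz.1
  have h0 : 1 - z * star t ≠ 0 := by
    have := one_sub_star_mul_ne_zero hz1 ht.le
    intro h0
    apply this
    have := congrArg star h0
    simpa [mul_comm] using this
  rw [h.eq_mul_integral ht hf hH hz1, mul_div_cancel_left₀ _ h0]

/-- The lower semicontinuity estimate for the boundary integral. -/
theorem HasRadialBoundary.lintegral_le_liminf (h : HasRadialBoundary f F C)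
    (hF : ∀ᵐ θ ∂angleMeasure, 0 ≤ (F θ).re) {x : ℕ → ℂ}
    (hx : Tendsto x atTop (𝓝[Metric.ball 0 1] t)) :
    ∫⁻ θ, ENNReal.ofReal (2 * (F θ).re / ‖unitExp θ - t‖ ^ 2) ∂angleMeasure ≤
      liminf (fun n => ENNReal.ofReal (2 * (f (x n)).re / (1 - ‖x n‖ ^ 2))) atTop := by
  obtain ⟨hx1, hx2⟩ := tendsto_nhdsWithin_iff.1 hx
  have hFm : AEMeasurable (fun θ => (F θ).re) angleMeasure :=
    Complex.measurable_re.comp_aemeasurable h.aestronglyMeasurable.aemeasurable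
  have e1 : ∫⁻ θ, ENNReal.ofReal (2 * (F θ).re / ‖unitExp θ - t‖ ^ 2) ∂angleMeasure
      = ∫⁻ θ, liminf (fun n => ENNReal.ofReal (2 * (F θ).re / ‖unitExp θ - x n‖ ^ 2)) atTop
          ∂angleMeasure := by
    refine lintegral_congr_ae ?_
    filter_upwards [ae_unitExp_ne t] with θ hθ
    have h0 : ‖unitExp θ - t‖ ^ 2 ≠ 0 := pow_ne_zero _ (norm_ne_zero_iff.2 (sub_ne_zero.2 hθ))
    exact (ENNReal.tendsto_ofReal
      (tendsto_const_nhds.div ((hx1.const_sub (unitExp θ)).norm.pow 2) h0)).liminf_eq.symm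
  -- With `t` replaced by `x n`, the integrand is a multiple of the Poisson kernel times `Re F`;
  -- Fatou's lemma then gives the estimate.
  have e2 : ∀ᶠ n in atTop,
      ∫⁻ θ, ENNReal.ofReal (2 * (F θ).re / ‖unitExp θ - x n‖ ^ 2) ∂angleMeasure
        = ENNReal.ofReal (2 * (f (x n)).re / (1 - ‖x n‖ ^ 2)) := by
    filter_upwards [hx2] with n hn
    have hn1 : ‖x n‖ < 1 := by simpa using hn
    have hp : 0 < 1 - ‖x n‖ ^ 2 := by nlinarith [norm_nonneg (x n)]
    have e3 : ∀ θ, 2 * (F θ).re / ‖unitExp θ - x n‖ ^ 2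
        = 2 / (1 - ‖x n‖ ^ 2) * (diskPoisson (x n) θ * (F θ).re) := fun θ => by
      unfold diskPoisson
      field_simp
    simp_rw [e3]
    rw [← ofReal_integral_eq_lintegral_ofReal ((h.integrable_re hn1).const_mul _) ?_,
      integral_const_mul, h.re_poisson_formula hn1]
    · congr 1; ring
    · filter_upwards [hF] with θ hθ
      have := diskPoisson_nonneg hn1 θ
      simp only [Pi.zero_apply]
      positivity
  rw [e1, ← liminf_congr e2]
  refine lintegral_liminf_le' fun n => ?_
  exact ((hFm.const_mul 2).div
    (((continuous_unitExp.sub continuous_const).norm.pow 2).measurable.aemeasurable)).ennreal_ofReal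

end

/-! ### The quadratic form -/

theorem quadForm_eq (v b : ℂ) : quadForm v b = 1 - 2 * (v * star b).re + ‖b‖ ^ 2 := by
  rw [← Complex.normSq_eq_norm_sq, Complex.normSq_apply]
  simp [quadForm, Matrix.mulVec, dotProduct, Fin.sum_univ_two]
  ring

theorem juliaD_eq (ω : ℂ → ℂ) (b : ℂ) {t : ℂ} (ht : ‖t‖ = 1) :
    juliaD ω b t = ∫⁻ θ, ENNReal.ofReal
      (quadForm (boundaryValue ω (unitExp θ)) b / ‖unitExp θ - t‖ ^ 2) ∂angleMeasure := by
  rw [juliaD, angleMeasure, lintegral_smul_measure, smul_eq_mul]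
  congr 1
  refine lintegral_congr fun θ => ?_
  rw [norm_one_sub_mul_star ht, norm_sub_rev, one_div_mul_eq_div]
  rfl

theorem quadForm_of_norm_eq_one {v b : ℂ} (hb : ‖b‖ = 1) :
    quadForm v b = 2 * (1 - v * star b).re := by
  rw [quadForm_eq, hb, Complex.sub_re, Complex.one_re]
  ring

theorem sq_le_quadForm {v b : ℂ} (hv : ‖v‖ ≤ 1) : (1 - ‖b‖) ^ 2 ≤ quadForm v b := by
  rw [quadForm_eq]
  have h1 : (v * star b).re ≤ ‖v‖ * ‖b‖ := by
    rw [← norm_star b, ← norm_mul]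
    exact Complex.re_le_norm _
  nlinarith [norm_nonneg b, norm_nonneg v]

/-- The chord length has no square-integrable inverse. -/
theorem not_integrable_inv_norm_sq {t : ℂ} (ht : ‖t‖ = 1) :
    ¬ Integrable (fun θ => 1 / ‖unitExp θ - t‖ ^ 2) angleMeasure := by
  intro h
  obtain ⟨C, hC⟩ := hasRadialBoundary_of_differentiable (g := fun _ => 1) (by fun_prop)
  -- For the constant function 1, integrability would give `1/(1 - z t*)` a finite limit at `t`.
  have h2 := hC.tendsto_div ht (by simp) (by simpa [div_eq_mul_inv] using h.const_mul 2)
  have htt : t * star t = 1 := by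
    have := Complex.mul_conj' t
    simpa [ht] using this
  have h3 : Tendsto (fun z : ℂ => 1 - z * star t) (nontangential t) (𝓝 0) := by
    have : Tendsto (fun z : ℂ => 1 - z * star t) (𝓝 t) (𝓝 (1 - t * star t)) :=
      Continuous.tendsto (by fun_prop) t
    rw [htt, sub_self] at this
    exact this.mono_left ((nontangential_le t).trans nhdsWithin_le_nhds)
  have h4 := h2.mul h3
  rw [mul_zero] at h4
  have := nontangential_neBot ht
  have h5 : Tendsto (fun _ : ℂ => (1 : ℂ)) (nontangential t) (𝓝 0) := by
    refine h4.congr' ?_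
    filter_upwards [nontangential_le t self_mem_nhdsWithin] with z hz
    refine div_mul_cancel₀ _ ?_
    rw [← norm_ne_zero_iff, norm_one_sub_mul_star ht, norm_ne_zero_iff, sub_ne_zero]
    rintro rfl
    simp [ht] at hz
  exact one_ne_zero (tendsto_nhds_unique tendsto_const_nhds h5)

theorem eq_of_one_sub_mul_star_eq_zero {v b : ℂ} (hb : ‖b‖ = 1) (h : 1 - v * star b = 0) :
    v = b := by
  rw [← norm_eq_zero, norm_one_sub_mul_star hb, norm_eq_zero] at h
  exact (sub_eq_zero.1 h).symm

/-! ### Finiteness, vanishing and boundary limits of `D` -/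

namespace IsSchur

variable {ω : ℂ → ℂ} {b t : ℂ}

theorem ae_norm_boundaryValue_le (hω : IsSchur ω) :
    ∀ᵐ θ ∂angleMeasure, ‖boundaryValue ω (unitExp θ)‖ ≤ 1 :=
  hω.hasRadialBoundary.ae_norm_le

theorem aestronglyMeasurable_quadForm_div (hω : IsSchur ω) (b t : ℂ) :
    AEStronglyMeasurable
      (fun θ => quadForm (boundaryValue ω (unitExp θ)) b / ‖unitExp θ - t‖ ^ 2) angleMeasure := by
  simp_rw [quadForm_eq]
  have h1 : AEMeasurable (fun θ => boundaryValue ω (unitExp θ)) angleMeasure :=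
    hω.hasRadialBoundary.aestronglyMeasurable.aemeasurable
  have h2 := Complex.measurable_re.comp_aemeasurable (h1.mul_const (star b))
  exact ((((h2.const_mul 2).const_sub 1).add_const _).div
    ((continuous_unitExp.sub continuous_const).norm.pow 2).measurable.aemeasurable).aestronglyMeasurable

theorem ae_quadForm_div_nonneg (hω : IsSchur ω) (b t : ℂ) :
    ∀ᵐ θ ∂angleMeasure,
      0 ≤ quadForm (boundaryValue ω (unitExp θ)) b / ‖unitExp θ - t‖ ^ 2 := by
  filter_upwards [hω.ae_norm_boundaryValue_le] with θ hθ
  have := (sq_nonneg _).trans (sq_le_quadForm (b := b) hθ)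
  positivity

theorem integrable_of_juliaD_lt_top (hω : IsSchur ω) (ht : ‖t‖ = 1) (h : juliaD ω b t < ⊤) :
    Integrable (fun θ => quadForm (boundaryValue ω (unitExp θ)) b / ‖unitExp θ - t‖ ^ 2)
      angleMeasure := by
  refine ⟨hω.aestronglyMeasurable_quadForm_div b t, ?_⟩
  rw [hasFiniteIntegral_iff_ofReal (hω.ae_quadForm_div_nonneg b t), ← juliaD_eq ω b ht]
  exact h

theorem juliaD_toReal (hω : IsSchur ω) (ht : ‖t‖ = 1) :
    (juliaD ω b t).toReal =
      ∫ θ, quadForm (boundaryValue ω (unitExp θ)) b / ‖unitExp θ - t‖ ^ 2 ∂angleMeasure := by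
  rw [integral_eq_lintegral_of_nonneg_ae (hω.ae_quadForm_div_nonneg b t)
    (hω.aestronglyMeasurable_quadForm_div b t), juliaD_eq ω b ht]

theorem norm_eq_one_of_juliaD_lt_top (hω : IsSchur ω) (ht : ‖t‖ = 1) (h : juliaD ω b t < ⊤) :
    ‖b‖ = 1 := by
  by_contra hb
  have hk : 0 < (1 - ‖b‖) ^ 2 := by
    have : 1 - ‖b‖ ≠ 0 := fun h0 => hb (by linarith)
    positivity
  refine not_integrable_inv_norm_sq ht ?_
  refine ((hω.integrable_of_juliaD_lt_top ht h).const_mul ((1 - ‖b‖) ^ 2)⁻¹).mono'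
    (measurable_const.div
      ((continuous_unitExp.sub continuous_const).norm.pow 2).measurable).aestronglyMeasurable ?_
  filter_upwards [hω.ae_norm_boundaryValue_le] with θ hθ
  rw [Real.norm_of_nonneg (by positivity), ← mul_div_assoc]
  have h1 : 1 ≤ ((1 - ‖b‖) ^ 2)⁻¹ * quadForm (boundaryValue ω (unitExp θ)) b := by
    rw [← div_eq_inv_mul, one_le_div hk]
    exact sq_le_quadForm hθ
  gcongr

theorem norm_mul_star_le (hω : IsSchur ω) (hb : ‖b‖ = 1) {z : ℂ}
    (hz : z ∈ Metric.ball (0 : ℂ) 1) : ‖ω z * star b‖ ≤ 1 := by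
  rw [norm_mul, norm_star, hb, mul_one]
  exact hω.2 z hz

theorem hasRadialBoundary_one_sub (hω : IsSchur ω) (hb : ‖b‖ = 1) :
    HasRadialBoundary (fun z => 1 - ω z * star b)
      (fun θ => 1 - boundaryValue ω (unitExp θ) * star b) 2 := by
  refine ⟨(hω.1.mul_const _).const_sub 1, fun z hz => ?_, ?_⟩
  · refine (norm_sub_le _ _).trans ?_
    have := hω.norm_mul_star_le hb hz
    rw [norm_one]
    linarith
  · filter_upwards [hω.hasRadialBoundary.tendsto] with θ hθ
    exact (hθ.mul_const _).const_sub 1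

theorem juliaD_le_liminf (hω : IsSchur ω) (ht : ‖t‖ = 1) (hb : ‖b‖ = 1) {x : ℕ → ℂ}
    (hx : Tendsto x atTop (𝓝[Metric.ball 0 1] t)) :
    juliaD ω b t ≤
      liminf (fun n => ENNReal.ofReal (2 * (1 - ω (x n) * star b).re / (1 - ‖x n‖ ^ 2))) atTop := by
  rw [juliaD_eq ω b ht]
  simp_rw [quadForm_of_norm_eq_one hb]
  refine (hω.hasRadialBoundary_one_sub hb).lintegral_le_liminf ?_ hx
  filter_upwards [hω.ae_norm_boundaryValue_le] with θ hθ
  have := (sq_nonneg _).trans (sq_le_quadForm (b := b) hθ)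
  rw [quadForm_of_norm_eq_one hb] at this
  linarith

theorem one_sub_mul_star_eq (hω : IsSchur ω) (ht : ‖t‖ = 1) (h : juliaD ω b t < ⊤) {z : ℂ}
    (hz : ‖z‖ < 1) :
    1 - ω z * star b = (1 - z * star t) * ∫ θ, (unitExp θ - t) / (unitExp θ - z) *
      ((quadForm (boundaryValue ω (unitExp θ)) b / ‖unitExp θ - t‖ ^ 2 : ℝ) : ℂ)
        ∂angleMeasure := by
  have hb := hω.norm_eq_one_of_juliaD_lt_top ht h
  have hI := hω.integrable_of_juliaD_lt_top ht h
  simp_rw [quadForm_of_norm_eq_one hb] at hI ⊢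
  exact (hω.hasRadialBoundary_one_sub hb).eq_mul_integral ht
    (fun z hz => by simpa using hω.norm_mul_star_le hb hz) hI hz

theorem tendsto_div_of_juliaD_lt_top (hω : IsSchur ω) (ht : ‖t‖ = 1) (h : juliaD ω b t < ⊤) :
    Tendsto (fun z => (1 - ω z * star b) / (1 - z * star t)) (nontangential t)
      (𝓝 (((juliaD ω b t).toReal : ℝ) : ℂ)) := by
  have hb := hω.norm_eq_one_of_juliaD_lt_top ht h
  have hI := hω.integrable_of_juliaD_lt_top ht h
  rw [hω.juliaD_toReal ht]
  simp_rw [quadForm_of_norm_eq_one hb] at hI ⊢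
  exact (hω.hasRadialBoundary_one_sub hb).tendsto_div ht
    (fun z hz => by simpa using hω.norm_mul_star_le hb hz) hI

theorem tendsto_of_juliaD_lt_top (hω : IsSchur ω) (ht : ‖t‖ = 1) (h : juliaD ω b t < ⊤) :
    Tendsto ω (nontangential t) (𝓝 b) := by
  have hb := hω.norm_eq_one_of_juliaD_lt_top ht h
  refine tendsto_of_tendsto_one_sub_mul_star hb ?_
  have h3 : Tendsto (fun z : ℂ => 1 - z * star t) (nontangential t) (𝓝 0) := by
    rw [tendsto_zero_iff_norm_tendsto_zero]
    simp_rw [norm_one_sub_mul_star ht]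
    have : Tendsto (fun z : ℂ => ‖t - z‖) (𝓝 t) (𝓝 ‖t - t‖) :=
      Continuous.tendsto (by fun_prop) t
    rw [sub_self, norm_zero] at this
    exact this.mono_left ((nontangential_le t).trans nhdsWithin_le_nhds)
  have h4 := (hω.tendsto_div_of_juliaD_lt_top ht h).mul h3
  rw [mul_zero] at h4
  refine h4.congr' ?_
  filter_upwards [nontangential_le t self_mem_nhdsWithin] with z hz
  refine div_mul_cancel₀ _ ?_
  rw [← norm_ne_zero_iff, norm_one_sub_mul_star ht, norm_ne_zero_iff, sub_ne_zero]
  rintro rfl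
  simp [ht] at hz

/-- On the radius `|1 - z t*| = 1 - r`, so the finite limit of the quotient bounds `|1 - ω b*|`, and
hence `1 - |ω|²`, by a multiple of `1 - r`. -/
theorem juliaLiminf_lt_top (hω : IsSchur ω) (ht : ‖t‖ = 1) (h : juliaD ω b t < ⊤) :
    juliaLiminf ω t < ⊤ := by
  have hb := hω.norm_eq_one_of_juliaD_lt_top ht h
  set M := ‖(((juliaD ω b t).toReal : ℝ) : ℂ)‖ + 1
  have h1 : ∀ᶠ r : ℝ in 𝓝[<] 1,
      ‖(1 - ω (r * t) * star b) / (1 - r * t * star t)‖ < M :=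
    ((hω.tendsto_div_of_juliaD_lt_top ht h).comp (tendsto_radial ht)).norm.eventually_lt_const
      (lt_add_one _)
  have h2 : ∀ᶠ r : ℝ in 𝓝[<] 1,
      (((1 - ‖ω (r * t)‖ ^ 2) / (1 - ‖(r * t : ℂ)‖ ^ 2) : ℝ) : EReal) ≤ ((2 * M : ℝ) : EReal) := by
    filter_upwards [h1, eventually_mem_Ioo_nhdsLT_one] with r hr1 hr
    rw [EReal.coe_le_coe_iff]
    have hrt : ‖(r * t : ℂ)‖ = r := by
      rw [norm_mul, Complex.norm_real, ht, mul_one, Real.norm_of_nonneg hr.1.le]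
    have hd : ‖1 - (r * t : ℂ) * star t‖ = 1 - r := by
      rw [norm_one_sub_mul_star ht]
      have : t - r * t = ((1 - r : ℝ) : ℂ) * t := by push_cast; ring
      rw [this, norm_mul, Complex.norm_real, ht, mul_one, Real.norm_of_nonneg (by linarith)]
    have hr0 : 0 < 1 - r := by linarith
    rw [norm_div, hd, div_lt_iff₀ hr0] at hr1
    have hb2 := one_sub_norm_sq_le hb (hω.2 _ (ofReal_mul_mem_ball hr ht.le))
    have hM : 0 < M := by positivity
    rw [hrt, div_le_iff₀ (by nlinarith)]
    have : M * (1 - r) ≤ M * (1 - r ^ 2) := by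
      gcongr
      nlinarith
    linarith
  have h3 : ∃ᶠ z in 𝓝[Metric.ball (0 : ℂ) 1] t,
      (((1 - ‖ω z‖ ^ 2) / (1 - ‖z‖ ^ 2) : ℝ) : EReal) ≤ ((2 * M : ℝ) : EReal) :=
    ((tendsto_radial ht).mono_right (nontangential_le t)).frequently h2.frequently
  exact (liminf_le_of_frequently_le' h3).trans_lt (EReal.coe_lt_top _)

/-- Julia's value must equal the given limit `b`. On the radius Julia's inequality bounds the
quantity in `juliaD_le_liminf` by `2 * M`. -/
theorem juliaD_lt_top (hω : IsSchur ω) (ht : ‖t‖ = 1) (h : juliaLiminf ω t < ⊤)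
    (hlim : Tendsto ω (nontangential t) (𝓝 b)) : juliaD ω b t < ⊤ := by
  obtain ⟨b', M, hb', hM, hineq⟩ := hω.julia ht h
  have := nontangential_neBot ht
  obtain rfl : b = b' :=
    tendsto_nhds_unique hlim (tendsto_nontangential_of_julia_inequality ht hb' hM hineq)
  obtain ⟨u, -, hu1, hu2⟩ := exists_seq_strictMono_tendsto' (show (0 : ℝ) < 1 by norm_num)
  have hu : Tendsto u atTop (𝓝[<] 1) :=
    tendsto_nhdsWithin_iff.2 ⟨hu2, Eventually.of_forall fun n => (hu1 n).2⟩
  have hx : Tendsto (fun n => (u n : ℂ) * t) atTop (𝓝[Metric.ball 0 1] t) :=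
    ((tendsto_radial ht).mono_right (nontangential_le t)).comp hu
  refine (hω.juliaD_le_liminf ht hb' hx).trans_lt ?_
  refine (liminf_le_of_frequently_le' (x := ENNReal.ofReal (2 * M))
    (Eventually.frequently (Eventually.of_forall fun n => ?_))).trans_lt ENNReal.ofReal_lt_top
  refine ENNReal.ofReal_le_ofReal ?_
  have hr := hu1 n
  generalize u n = r at hr
  have h1 := hineq _ (ofReal_mul_mem_ball hr ht.le)
  have hrt : ‖(r * t : ℂ)‖ = r := by
    rw [norm_mul, Complex.norm_real, ht, mul_one, Real.norm_of_nonneg hr.1.le]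
  have hd : ‖1 - (r * t : ℂ) * star t‖ = 1 - r := by
    rw [norm_one_sub_mul_star ht]
    have : t - r * t = ((1 - r : ℝ) : ℂ) * t := by push_cast; ring
    rw [this, norm_mul, Complex.norm_real, ht, mul_one, Real.norm_of_nonneg (by linarith [hr.2])]
  rw [hrt, hd] at h1
  have hr0 : 0 < 1 - r := by linarith [hr.2]
  have hp : 1 - r ≤ 1 - r ^ 2 := by nlinarith [hr.1]
  rw [hrt, div_le_iff₀ (by linarith)]
  have h2 := Complex.re_le_norm (1 - ω (r * t) * star b)
  have h3 : ‖1 - ω (r * t) * star b‖ ≤ M * (1 - r) := by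
    refine le_of_mul_le_mul_right ?_ hr0
    calc _ ≤ ‖1 - ω (r * t) * star b‖ * (1 - r ^ 2) := by gcongr
      _ ≤ _ := by linarith
  have h4 : M * (1 - r) ≤ M * (1 - r ^ 2) := by gcongr
  linarith

theorem juliaD_eq_zero_iff (hω : IsSchur ω) (ht : ‖t‖ = 1) :
    juliaD ω b t = 0 ↔ (∀ z ∈ Metric.ball (0 : ℂ) 1, ω z = b) ∧ ‖b‖ = 1 := by
  constructor
  · intro h
    have hfin : juliaD ω b t < ⊤ := by simp [h]
    have hb := hω.norm_eq_one_of_juliaD_lt_top ht hfin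
    refine ⟨fun z hz => eq_of_one_sub_mul_star_eq_zero hb ?_, hb⟩
    rw [hω.one_sub_mul_star_eq ht hfin (by simpa using hz)]
    have h0 := hω.juliaD_toReal (b := b) ht
    rw [h, ENNReal.toReal_zero, eq_comm, integral_eq_zero_iff_of_nonneg_ae
      (hω.ae_quadForm_div_nonneg b t) (hω.integrable_of_juliaD_lt_top ht hfin)] at h0
    -- A nonnegative density with zero integral vanishes a.e., so the representation of `1 - ω b*`
    -- collapses to 0.
    rw [integral_eq_zero_of_ae, mul_zero]
    filter_upwards [h0] with θ hθ
    rw [hθ]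
    simp
  · rintro ⟨h, hb⟩
    rw [juliaD_eq ω b ht]
    have hv : ∀ θ, boundaryValue ω (unitExp θ) = b := fun θ => by
      refine boundaryValue_eq (norm_unitExp θ) (tendsto_const_nhds.congr' ?_)
      filter_upwards [nontangential_le _ self_mem_nhdsWithin] with z hz
      exact (h z hz).symm
    have h1 : 1 - b * star b = 0 := by
      rw [← norm_eq_zero, norm_one_sub_mul_star hb, sub_self, norm_zero]
    simp_rw [hv, quadForm_of_norm_eq_one hb, h1]
    simp

theorem tendsto_norm_div_of_juliaD_eq_top (hω : IsSchur ω) (ht : ‖t‖ = 1) (hb : ‖b‖ ≤ 1)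
    (h : juliaD ω b t = ⊤) :
    Tendsto (fun z => ‖(1 - ω z * star b) / (1 - z * star t)‖) (nontangential t) atTop := by
  refine tendsto_nontangential_iff.2 fun a ha => ?_
  -- If `|b| < 1`, the numerator is at least `1 - |b|` while the denominator tends to 0. If `|b| =
  -- 1`, the Fatou bound applies along every sequence in the Stolz region.
  rcases hb.lt_or_eq with hb | hb
  · have h1 : Tendsto (fun z : ℂ => ‖1 - z * star t‖) (𝓝[stolzRegion a t] t) (𝓝[>] 0) := by
      simp_rw [norm_one_sub_mul_star ht]
      refine tendsto_nhdsWithin_iff.2 ⟨?_, ?_⟩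
      · have : Tendsto (fun z : ℂ => ‖t - z‖) (𝓝 t) (𝓝 ‖t - t‖) :=
          Continuous.tendsto (by fun_prop) t
        rw [sub_self, norm_zero] at this
        exact this.mono_left nhdsWithin_le_nhds
      · filter_upwards [self_mem_nhdsWithin] with z hz
        have hz1 := hz.1
        refine norm_pos_iff.2 (sub_ne_zero.2 ?_)
        rintro rfl
        simp [ht] at hz1
    have h2 := (tendsto_inv_nhdsGT_zero.comp h1).const_mul_atTop (sub_pos.2 hb)
    refine tendsto_atTop_mono' _ ?_ h2
    filter_upwards [self_mem_nhdsWithin] with z hz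
    simp only [Function.comp_apply]
    rw [norm_div, div_eq_mul_inv]
    gcongr
    have h3 : ‖ω z * star b‖ ≤ ‖b‖ := by
      rw [norm_mul, norm_star]
      exact mul_le_of_le_one_left (norm_nonneg _) (hω.2 z hz.1)
    have h4 : 1 - ‖ω z * star b‖ ≤ ‖1 - ω z * star b‖ := by
      simpa using norm_sub_norm_le 1 (ω z * star b)
    linarith
  · refine tendsto_of_seq_tendsto fun x hx => ?_
    have hx' : Tendsto x atTop (𝓝[Metric.ball 0 1] t) :=
      hx.mono_right (nhdsWithin_mono _ fun z hz => hz.1)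
    have h1 := hω.juliaD_le_liminf ht hb hx'
    rw [h, top_le_iff] at h1
    have h2 := tendsto_of_le_liminf_of_limsup_le h1.ge le_top
    rw [ENNReal.tendsto_ofReal_nhds_top] at h2
    have h3 := h2.const_mul_atTop (show 0 < (2 * a)⁻¹ by positivity)
    refine tendsto_atTop_mono' _ ?_ h3
    filter_upwards [(tendsto_nhdsWithin_iff.1 hx).2] with n hn
    simp only [Function.comp_apply]
    generalize x n = z at hn
    obtain ⟨hzb, hza⟩ := hn
    have hz1 : ‖z‖ < 1 := by simpa using hzb
    have hp : 1 - ‖z‖ ≤ 1 - ‖z‖ ^ 2 := by nlinarith [norm_nonneg z]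
    have hp0 : 0 < 1 - ‖z‖ ^ 2 := by linarith
    have hd : 0 < ‖t - z‖ := by
      refine norm_pos_iff.2 (sub_ne_zero.2 ?_)
      rintro rfl
      linarith
    have hre : 0 ≤ (1 - ω z * star b).re := by
      have h5 := (Complex.re_le_norm _).trans (hω.norm_mul_star_le hb hzb)
      rw [Complex.sub_re, Complex.one_re]
      linarith
    rw [norm_div, norm_one_sub_mul_star ht]
    -- The factor `(2a)⁻¹` absorbs the 2 and the aperture, since `|t - z| < a(1 - |z|) ≤ a(1 -
    -- |z|²)`.
    have e : (2 * a)⁻¹ * (2 * (1 - ω z * star b).re / (1 - ‖z‖ ^ 2))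
        = (1 - ω z * star b).re / (a * (1 - ‖z‖ ^ 2)) := by
      field_simp
    rw [e]
    have h6 : a * (1 - ‖z‖) ≤ a * (1 - ‖z‖ ^ 2) := by gcongr
    exact div_le_div₀ (norm_nonneg _) (Complex.re_le_norm _) hd (by linarith)

theorem juliaD_lt_top_iff (hω : IsSchur ω) (ht : ‖t‖ = 1) :
    juliaD ω b t < ⊤ ↔ juliaLiminf ω t < ⊤ ∧ Tendsto ω (nontangential t) (𝓝 b) :=
  ⟨fun h => ⟨hω.juliaLiminf_lt_top ht h, hω.tendsto_of_juliaD_lt_top ht h⟩,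
    fun h => hω.juliaD_lt_top ht h.1 h.2⟩

end IsSchur

theorem theorem7p2 (ω : ℂ → ℂ) (hω : IsSchur ω) (t₀ : ℂ) (ht₀ : ‖t₀‖ = 1) (b : ℂ) :
    -- finiteness of `D`
    (juliaD ω b t₀ < ⊤ ↔
      juliaLiminf ω t₀ < ⊤ ∧ Tendsto ω (nontangential t₀) (𝓝 b)) ∧
    (juliaD ω b t₀ < ⊤ → ‖b‖ = 1) ∧
    -- infiniteness of `D`
    (juliaD ω b t₀ = ⊤ ↔
      juliaLiminf ω t₀ = ⊤ ∨ ¬ Tendsto ω (nontangential t₀) (𝓝 b)) ∧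
    -- vanishing of `D`
    (juliaD ω b t₀ = 0 ↔
      (∀ z ∈ Metric.ball (0 : ℂ) 1, ω z = b) ∧ ‖b‖ = 1) ∧
    -- the boundary limit; an infinite value is understood in the extended complex plane
    (‖b‖ ≤ 1 →
      (juliaD ω b t₀ < ⊤ →
        Tendsto (fun z => (1 - ω z * star b) / (1 - z * star t₀)) (nontangential t₀)
          (𝓝 (((juliaD ω b t₀).toReal : ℝ) : ℂ))) ∧
      (juliaD ω b t₀ = ⊤ →
        Tendsto (fun z => ‖(1 - ω z * star b) / (1 - z * star t₀)‖) (nontangential t₀)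
          atTop)) := by
  refine ⟨hω.juliaD_lt_top_iff ht₀, hω.norm_eq_one_of_juliaD_lt_top ht₀, ?_,
    hω.juliaD_eq_zero_iff ht₀, fun hb => ⟨hω.tendsto_div_of_juliaD_lt_top ht₀,
      hω.tendsto_norm_div_of_juliaD_eq_top ht₀ hb⟩⟩
  have h := hω.juliaD_lt_top_iff (b := b) ht₀
  rw [lt_top_iff_ne_top, lt_top_iff_ne_top] at h
  tauto
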